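/- Let $X$ be a (Hausdorff, finite-dimensional) complex manifold, let $\omega_0,\omega_1$ be holomorphic symplectic two-forms on $X$ (holomorphic $(2,0)$-forms that are closed and everywhere nondegenerate), and let $Y\subseteq X$ be a complex submanifold such that $\omega_0$ and $\omega_1$ coincide on $TX|_Y$, i.e. $(\omega_0)_y=(\omega_1)_y$ as bilinear forms on $T_yX$ for every $y\in Y$. Suppose there are an open neighbourhood $U$ of $Y$ in $X$ and a differentiable family of holomorphic maps $\varphi_t:U\to U$, $0\le t\le 1$ (that is, $(t,x)\mapsto\varphi_t(x)$ is continuously differentiable on $[0,1]\times U$ and each $\varphi_t$ is holomorphic), such that $$\varphi_1=\mathrm{id}_U,\qquad \varphi_0(U)=Y,\qquad \varphi_t|_Y=\mathrm{id}_Y\quad\text{for all } t\in[0,1].$$ Then there exist an open neighbourhood $U'$ of $Y$ with $U'\subseteq U$ and a biholomorphic map $f:U'\to f(U')$ onto an open subset $f(U')$ of $X$ such that $$f|_Y=\mathrm{id}_Y\qquad\text{and}\qquad f^*\omega_1=\omega_0 \text{ on } U'.$$ If moreover a compact Lie group $K$ acts smoothly on $X$ by holomorphic maps, $\omega_0$ and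 $\omega_1$ are $K$-invariant, $Y$ and $U$ are $K$-invariant subsets, and each $\varphi_t$ is $K$-equivariant, then $U'$ and $f$ can be chosen such that $U'$ is $K$-invariant and $f(kx)=kf(x)$ for all $k\in K$, $x\in U'$. -/

import Mathlib

open Set
open scoped Manifold ContDiff

namespace HolSymp

/-- A (pointwise) complex-bilinear alternating two-form on a manifold modelled on the complex
vector space `E`, i.e. a form of type `(2,0)`; no regularity in the base point is required. -/
abbrev TwoForm (E : Type*) [NormedAddCommGroup E] [NormedSpace ℂ E]
    (M : Type*) [TopologicalSpace M] [ChartedSpace E M] :=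
  (x : M) → TangentSpace 𝓘(ℂ, E) x [⋀^Fin 2]→L[ℂ] ℂ

section

variable {E : Type*} [NormedAddCommGroup E] [NormedSpace ℂ E]
  {M : Type*} [TopologicalSpace M] [ChartedSpace E M]
  {N : Type*} [TopologicalSpace N] [ChartedSpace E N]

/-- The pull-back `f^* η`, given by `(f^* η)_x (v, w) = η_{f x} (df_x v, df_x w)`. It is meant to
be used at points `x` at which `f` is holomorphic. -/
noncomputable def pullback (f : M → N) (η : TwoForm E N) : TwoForm E M := fun x =>
  (η (f x)).compContinuousLinearMap (mfderiv 𝓘(ℂ, E) 𝓘(ℂ, E) f x)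

/-- The expression of a two-form in the chart `e`: the pull-back of the form along `e.symm`, a form
on the open subset `e.target` of the vector space `E`. -/
noncomputable def inChart (η : TwoForm E M) (e : OpenPartialHomeomorph M E) :
    E → E [⋀^Fin 2]→L[ℂ] ℂ :=
  pullback (M := E) e.symm η

/-- A holomorphic symplectic form: a two-form which is holomorphic in every holomorphic chart,
closed, and nondegenerate at every point. -/
structure IsHolomorphicSymplectic (η : TwoForm E M) : Prop where
  holomorphic : ∀ e ∈ IsManifold.maximalAtlas 𝓘(ℂ, E) ω M,
    DifferentiableOn ℂ (inChart η e) e.target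
  closed : ∀ e ∈ IsManifold.maximalAtlas 𝓘(ℂ, E) ω M,
    ∀ z ∈ e.target, extDeriv (inChart η e) z = 0
  nondegenerate : ∀ (x : M) (v : TangentSpace 𝓘(ℂ, E) x),
    (∀ w : TangentSpace 𝓘(ℂ, E) x, η x ![v, w] = 0) → v = 0

variable (E) in
/-- A complex (embedded) submanifold: near each of its points there is a holomorphic chart in which
it becomes a complex linear subspace. The dimension may vary from point to point. -/
def IsComplexSubmanifold (Y : Set M) : Prop :=
  ∀ y ∈ Y, ∃ e ∈ IsManifold.maximalAtlas 𝓘(ℂ, E) ω M, y ∈ e.source ∧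
    ∃ F : Submodule ℂ E, ∀ x ∈ e.source, x ∈ Y ↔ e x ∈ F

variable (E) in
/-- A differentiable family `φ t : U → U`, `0 ≤ t ≤ 1`, of holomorphic maps with `φ 1 = id`,
`φ 0 (U) = Y` and `φ t = id` on `Y` for all `t`. The values of `φ t x` for `t` outside `[0, 1]` or
`x` outside `U` play no role. -/
structure IsHolomorphicRetractionFamily (U Y : Set M) (φ : ℝ → M → M) : Prop where
  mapsTo : ∀ t ∈ Icc (0 : ℝ) 1, MapsTo (φ t) U U
  holomorphic : ∀ t ∈ Icc (0 : ℝ) 1, MDifferentiableOn 𝓘(ℂ, E) 𝓘(ℂ, E) (φ t) U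
  differentiable : ContMDiffOn (𝓘(ℝ, ℝ).prod 𝓘(ℝ, E)) 𝓘(ℝ, E) 1
    (fun p : ℝ × M => φ p.1 p.2) (Icc (0 : ℝ) 1 ×ˢ U)
  map_one : EqOn (φ 1) id U
  image_zero : φ 0 '' U = Y
  fix : ∀ t ∈ Icc (0 : ℝ) 1, EqOn (φ t) id Y

/-- `f` is a biholomorphic map from the open neighbourhood `f.source ⊆ U` of `Y` onto the open set
`f.target`, it is the identity on `Y`, and `f^* η₁ = η₀` on `f.source`. -/
structure IsRelativeSymplectomorphism (η₀ η₁ : TwoForm E M) (Y U : Set M)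
    (f : OpenPartialHomeomorph M M) : Prop where
  subset_source : Y ⊆ f.source
  source_subset : f.source ⊆ U
  holomorphic : MDifferentiableOn 𝓘(ℂ, E) 𝓘(ℂ, E) f f.source
  holomorphic_symm : MDifferentiableOn 𝓘(ℂ, E) 𝓘(ℂ, E) f.symm f.target
  fix : EqOn f id Y
  pullback_eq : ∀ x ∈ f.source, pullback f η₁ x = η₀ x

end

end HolSymp

/-! This is Moser's trick, carried out holomorphically and relative to `Y`. Put ω_t = ω₀ + t(ω₁ −
ω₀). The homotopy φ yields a one-form σ = ∫₀¹ (ω₁ − ω₀)_{φ_t}(∂_t φ_t, dφ_t ·) dt. By Cartan's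
formula, dσ = φ₁^*(ω₁ − ω₀) − φ₀^*(ω₁ − ω₀). This equals ω₁ − ω₀, because φ₁ is the identity and φ₀
lands in `Y`, where the two forms agree. Moreover σ vanishes at the points of `Y`, since φ_t does
not move them.

At points of `Y` every ω_t equals ω₀, so near `Y` all ω_t are nondegenerate and ω_t(v_t, ·) = −σ
determines a holomorphic time-dependent vector field vanishing on `Y`. Near `Y` its flow ψ_t lives
beyond time 1, and the t-derivative of ψ_t^*ω_t is ψ_t^*(d(ω_t(v_t, ·)) + ω₁ − ω₀) = 0. Hence f = ψ₁
fixes `Y` and satisfies f^*ω₁ = ω₀.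

The local analysis rests on three results: `IsHolomorphicHomotopy.homotopyForm_spec` (the relative
Poincaré lemma), `exists_holomorphic_flow` (holomorphic dependence on the initial point) and
`IsMoserData.exists_flow` (Moser's trick in a chart). Time ranges over (−1, 2), so that 0 and 1 are
interior and two-sided derivatives are available.

The passage to the manifold rests on uniqueness of integral curves, `eqOn_of_isMoserCurve`. It glues
the local flows, makes the time-one map injective, and gives equivariance without averaging: σ and
ω_t are built from invariant data, so a group element carries integral curves to integral curves.
Finally `exists_openPartialHomeomorph_of_injOn` turns the injective time-one map into a
biholomorphism onto an open set. -/

namespace HolSymp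

/-! ### Holomorphic maps depending on a real parameter -/

section Holomorphic

open Metric Filter Topology

variable {E : Type*} [NormedAddCommGroup E] [NormedSpace ℂ E]
  {F : Type*} [NormedAddCommGroup F] [NormedSpace ℂ F]

/-- Cauchy's estimate for the difference of the derivatives of two holomorphic maps. -/
theorem norm_fderiv_sub_fderiv_le {f g : E → F} {c d : E} {R C : ℝ} (hR : 0 < R)
    (hf : DifferentiableOn ℂ f (ball c R)) (hg : DifferentiableOn ℂ g (ball d R))
    (h : ∀ w ∈ ball (0 : E) R, ‖f (c + w) - g (d + w)‖ ≤ C) :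
    ‖fderiv ℂ f c - fderiv ℂ g d‖ ≤ (C + C) / R := by
  have hf' : DifferentiableOn ℂ (fun w => f (c + w)) (ball 0 R) :=
    hf.comp (by fun_prop) fun w hw => by simpa using hw
  have hg' : DifferentiableOn ℂ (fun w => g (d + w)) (ball 0 R) :=
    hg.comp (by fun_prop) fun w hw => by simpa using hw
  have h0 : ball (0 : E) R ∈ 𝓝 0 := ball_mem_nhds _ hR
  -- The estimate needs the image to lie in a ball about the value at the centre; two vectors of
  -- norm at most `C` differ by at most `C + C`.
  have key := Complex.norm_fderiv_le_div_of_mapsTo_ball (R₂ := C + C) (hf'.sub hg')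
    (fun w hw => by
      rw [mem_closedBall, dist_eq_norm]
      exact (norm_sub_le _ _).trans (add_le_add (h w hw) (h 0 (mem_ball_self hR)))) hR
  rw [fderiv_sub (hf'.differentiableAt h0) (hg'.differentiableAt h0)] at key
  simpa only [fderiv_comp_add_left, add_zero] using key

/-- The derivative of a continuous family of holomorphic maps is jointly continuous. -/
theorem continuousOn_fderiv_of_differentiableOn [FiniteDimensional ℂ E]
    {T : Type*} [TopologicalSpace T] {S : Set T}
    {V : Set E} (hV : IsOpen V) {h : T → E → F} (hc : ContinuousOn (Function.uncurry h) (S ×ˢ V))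
    (hd : ∀ t ∈ S, DifferentiableOn ℂ (h t) V) :
    ContinuousOn (fun p : T × E => fderiv ℂ (h p.1) p.2) (S ×ˢ V) := by
  have : ProperSpace E := FiniteDimensional.proper ℂ E
  rintro ⟨t₀, z₀⟩ ⟨ht₀, hz₀⟩
  obtain ⟨r, hr, hrV⟩ := isOpen_iff.1 hV z₀ hz₀
  obtain ⟨R, hR, rfl⟩ : ∃ R > 0, r = 2 * R := ⟨r / 2, by positivity, by ring⟩
  have hcw : ContinuousOn (Function.uncurry fun (p : T × E) (w : E) => h p.1 (p.2 + w))
      ((S ×ˢ ball z₀ R) ×ˢ closedBall 0 R) := by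
    refine hc.comp (f := fun q : (T × E) × E => (q.1.1, q.1.2 + q.2)) (by fun_prop) ?_
    rintro ⟨⟨t, z⟩, w⟩ ⟨⟨ht, hz⟩, hw⟩
    refine ⟨ht, hrV ?_⟩
    rw [mem_ball_iff_norm] at hz ⊢
    rw [mem_closedBall_zero_iff] at hw
    calc ‖z + w - z₀‖ = ‖(z - z₀) + w‖ := by congr 1; abel
      _ < 2 * R := by linarith [norm_add_le (z - z₀) w]
  have hball : ∀ z ∈ ball z₀ R, ball z R ⊆ V := fun z hz w hw => hrV <| by
    rw [mem_ball] at *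
    linarith [dist_triangle w z z₀]
  rw [Metric.continuousWithinAt_iff']
  intro ε hε
  -- Compactness of the closed ball makes continuity in the parameter uniform in `w`. Cauchy's
  -- estimate then turns `ε * R / 3` into `2 * ε / 3`.
  obtain ⟨v, hv, hvε⟩ := (isCompact_closedBall (0 : E) R).mem_uniformity_of_prod hcw
    (q := (t₀, z₀)) ⟨ht₀, mem_ball_self hR⟩ (dist_mem_uniformity (show 0 < ε * R / 3 by positivity))
  have hnhds : 𝓝[S ×ˢ ball z₀ R] (t₀, z₀) = 𝓝[S ×ˢ V] (t₀, z₀) := by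
    rw [nhdsWithin_prod_eq, nhdsWithin_prod_eq, isOpen_ball.nhdsWithin_eq (mem_ball_self hR),
      hV.nhdsWithin_eq hz₀]
  filter_upwards [hnhds ▸ hv, hnhds ▸ self_mem_nhdsWithin (s := S ×ˢ ball z₀ R)] with p hp hpS
  rw [dist_eq_norm]
  refine (norm_fderiv_sub_fderiv_le hR ((hd _ hpS.1).mono (hball _ hpS.2))
    ((hd _ ht₀).mono (hball _ (mem_ball_self hR))) (C := ε * R / 3) fun w hw => ?_).trans_lt ?_
  · have := hvε p hp w (ball_subset_closedBall hw)
    simp only [mem_ofPred_eq, dist_eq_norm] at this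
    exact this.le
  · rw [div_lt_iff₀ hR]
    nlinarith [mul_pos hε hR]

/-- A locally uniform limit of holomorphic maps is holomorphic, and its derivative is the limit of
the derivatives. -/
theorem hasFDerivAt_limit_of_differentiableOn [CompleteSpace F] {ι : Type*} {l : Filter ι} [l.NeBot]
    {c : E} {R : ℝ} (hR : 0 < R) {q : ι → E → F} {f : E → F}
    (hq : ∀ᶠ i in l, DifferentiableOn ℂ (q i) (ball c R))
    (hlim : TendstoUniformlyOn q f l (ball c R)) :
    DifferentiableAt ℂ f c ∧ Tendsto (fun i => fderiv ℂ (q i) c) l (𝓝 (fderiv ℂ f c)) := by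
  have hsub : ∀ z ∈ ball c (R / 2), ball z (R / 2) ⊆ ball c R := fun z hz w hw => by
    rw [mem_ball] at *
    linarith [dist_triangle w z c]
  have hcau : UniformCauchySeqOn (fun i => fderiv ℂ (q i)) l (ball c (R / 2)) := by
    intro u hu
    obtain ⟨ε, hε, hεu⟩ := Metric.mem_uniformity_dist.1 hu
    -- The balls now have radius `R / 2`, so Cauchy's estimate turns `ε * R / 5` into `4 * ε / 5`.
    have h1 := hlim.uniformCauchySeqOn _ (dist_mem_uniformity (show 0 < ε * R / 5 by positivity))
    filter_upwards [h1, hq.prod_mk hq] with p hp hpd z hz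
    refine hεu ?_
    rw [dist_eq_norm]
    refine (norm_fderiv_sub_fderiv_le (half_pos hR) (hpd.1.mono (hsub z hz))
      (hpd.2.mono (hsub z hz)) (C := ε * R / 5) fun w hw => ?_).trans_lt ?_
    · have := hp (z + w) (hsub z hz (by simpa using hw))
      simp only [dist_eq_norm] at this
      exact this.le
    · rw [div_lt_iff₀ (half_pos hR)]
      nlinarith [mul_pos hε hR]
  have hG : ∀ z, ∃ G, z ∈ ball c (R / 2) → Tendsto (fun i => fderiv ℂ (q i) z) l (𝓝 G) := by
    intro z
    by_cases hz : z ∈ ball c (R / 2)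
    · obtain ⟨G, hG⟩ := CompleteSpace.complete (hcau.cauchy_map hz)
      exact ⟨G, fun _ => hG⟩
    · exact ⟨0, fun h => absurd h hz⟩
  choose G hG using hG
  have hb : ball c (R / 2) ∈ 𝓝 c := ball_mem_nhds _ (half_pos hR)
  have hfd : HasFDerivAt f (G c) c := by
    refine hasFDerivAt_of_tendstoUniformlyOnFilter (l := l) (f := q)
      (f' := fun i => fderiv ℂ (q i)) ?_ ?_ ?_
    · have := (hcau.tendstoUniformlyOn_of_tendsto fun z hz => hG z hz)
      exact this.tendstoUniformlyOnFilter.mono_right (le_principal_iff.2 hb)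
    · filter_upwards [hq.prod_mk hb] with p hp
      exact (hp.1.differentiableAt (isOpen_ball.mem_nhds
        (hsub p.2 hp.2 (mem_ball_self (half_pos hR))))).hasFDerivAt
    · filter_upwards [hb] with z hz
      exact hlim.tendsto_at (hsub z hz (mem_ball_self (half_pos hR)))
  exact ⟨hfd.differentiableAt, by
    rw [hfd.fderiv]; exact hG c (mem_ball_self (half_pos hR))⟩

/-- If a family of holomorphic maps is continuously differentiable in the parameter, then its
parameter derivative is holomorphic, and the two derivatives commute. -/
theorem hasDerivWithinAt_fderiv_of_hasDerivWithinAt [FiniteDimensional ℂ E] [CompleteSpace F]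
    {I : Set ℝ} (hI : Convex ℝ I) {V : Set E} (hV : IsOpen V) {h h' : ℝ → E → F}
    (hd : ∀ t ∈ I, DifferentiableOn ℂ (h t) V)
    (hder : ∀ t ∈ I, ∀ z ∈ V, HasDerivWithinAt (fun s => h s z) (h' t z) I t)
    (hc : ContinuousOn (Function.uncurry h') (I ×ˢ V))
    {t : ℝ} (ht : t ∈ I) (hu : UniqueDiffWithinAt ℝ I t) {z : E} (hz : z ∈ V) :
    DifferentiableAt ℂ (h' t) z ∧
      HasDerivWithinAt (fun s => fderiv ℂ (h s) z) (fderiv ℂ (h' t) z) I t := by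
  have : ProperSpace E := FiniteDimensional.proper ℂ E
  obtain ⟨R, hR, hRV⟩ := nhds_basis_closedBall.mem_iff.1 (hV.mem_nhds hz)
  have hbV : ball z R ⊆ V := ball_subset_closedBall.trans hRV
  have hne : (𝓝[I \ {t}] t).NeBot :=
    accPt_principal_iff_nhdsWithin.1 (uniqueDiffWithinAt_iff_accPt.1 hu)
  have hmem : ∀ᶠ s in 𝓝[I \ {t}] t, s ∈ I ∧ s ≠ t := by
    filter_upwards [self_mem_nhdsWithin] with s hs using hs
  have hunif : TendstoUniformlyOn (fun s w => slope (fun τ => h τ w) t s) (h' t) (𝓝[I \ {t}] t)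
      (ball z R) := by
    rw [Metric.tendstoUniformlyOn_iff]
    intro ε hε
    obtain ⟨v, hv, hvε⟩ := (isCompact_closedBall z R).mem_uniformity_of_prod
      (hc.mono (prod_mono_right hRV)) ht (dist_mem_uniformity (half_pos hε))
    obtain ⟨δ, hδ, hδv⟩ := Metric.mem_nhdsWithin_iff.1 hv
    filter_upwards [hmem, mem_nhdsWithin_of_mem_nhds (ball_mem_nhds t hδ)] with s hs hsδ w hw
    -- The mean value inequality for `s ↦ h s w - s • h' t w`, whose derivative is small near `t`
    -- uniformly in `w`, bounds the error of the difference quotient uniformly in `w`.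
    have hder' : ∀ τ ∈ ball t δ ∩ I, HasDerivWithinAt (fun s => h s w - s • h' t w)
        (h' τ w - h' t w) (ball t δ ∩ I) τ := fun τ hτ => by
      have h1 := (hder τ hτ.2 w (hbV hw)).mono (inter_subset_right (s := ball t δ))
      have h2 := ((hasDerivAt_id τ).smul_const (h' t w)).hasDerivWithinAt (s := ball t δ ∩ I)
      rw [one_smul] at h2
      exact h1.sub h2
    have key := Convex.norm_image_sub_le_of_norm_hasDerivWithin_le (C := ε / 2) hder'
      (fun τ hτ => by
        have := hvε τ (hδv hτ) w (ball_subset_closedBall hw)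
        simp only [dist_eq_norm] at this
        exact this.le) ((convex_ball t δ).inter hI) ⟨mem_ball_self hδ, ht⟩ ⟨hsδ, hs.1⟩
    have hst : s - t ≠ 0 := sub_ne_zero.2 hs.2
    have hst' : 0 < ‖s - t‖ := norm_pos_iff.2 hst
    rw [dist_comm, dist_eq_norm, slope_def_module]
    have heq : (s - t)⁻¹ • (h s w - h t w) - h' t w
        = (s - t)⁻¹ • (h s w - s • h' t w - (h t w - t • h' t w)) := by
      have : h' t w = (s - t)⁻¹ • ((s - t) • h' t w) := by rw [smul_smul, inv_mul_cancel₀ hst, one_smul]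
      conv_lhs => rw [this]
      rw [← smul_sub, sub_smul]
      congr 1
      abel
    rw [heq, norm_smul, norm_inv, inv_mul_lt_iff₀ hst']
    nlinarith [mul_pos hε hst']
  have hdq : ∀ᶠ s in 𝓝[I \ {t}] t,
      DifferentiableOn ℂ (fun w => slope (fun τ => h τ w) t s) (ball z R) := by
    filter_upwards [hmem] with s hs
    simp only [slope_def_module]
    exact (((hd s hs.1).mono hbV).sub ((hd t ht).mono hbV)).const_smul _
  obtain ⟨h1, h2⟩ := hasFDerivAt_limit_of_differentiableOn hR hdq hunif
  refine ⟨h1, hasDerivWithinAt_iff_tendsto_slope.2 (h2.congr' ?_)⟩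
  filter_upwards [hmem] with s hs
  have hs1 := (hd s hs.1).differentiableAt (hV.mem_nhds hz)
  have hs2 := (hd t ht).differentiableAt (hV.mem_nhds hz)
  simp only [slope_def_module]
  rw [← fderiv_fun_sub hs1 hs2]
  exact fderiv_const_smul (hs1.sub hs2) _

/-- Directional derivatives of a holomorphic map are holomorphic. -/
theorem differentiableOn_fderiv_apply [FiniteDimensional ℂ E] [CompleteSpace F] {V : Set E}
    (hV : IsOpen V) {g : E → F} (hg : DifferentiableOn ℂ g V) (v : E) :
    DifferentiableOn ℂ (fun z => fderiv ℂ g z v) V := by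
  intro z hz
  obtain ⟨r, hr, hrV⟩ := isOpen_iff.1 hV z hz
  obtain ⟨δ, hδ, hδr⟩ : ∃ δ > 0, δ * ‖v‖ ≤ r / 2 := by
    refine ⟨r / 2 / (‖v‖ + 1), by positivity, ?_⟩
    rw [div_mul_eq_mul_div, div_le_iff₀ (by positivity)]
    nlinarith [norm_nonneg v]
  have hin : ∀ s ∈ ball (0 : ℝ) δ, ∀ w ∈ ball z (r / 2), w + s • v ∈ V := fun s hs w hw => hrV <| by
    rw [mem_ball_iff_norm] at *
    have : ‖s • v‖ ≤ δ * ‖v‖ := by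
      rw [norm_smul]; gcongr; simpa using hs.le
    calc ‖w + s • v - z‖ = ‖(w - z) + s • v‖ := by congr 1; abel
      _ < r := by linarith [norm_add_le (w - z) (s • v)]
  have hcf : ContinuousOn (fun z => fderiv ℂ g z) V := by
    have := continuousOn_fderiv_of_differentiableOn (T := Unit) (S := univ) hV (h := fun _ => g)
      (hg.continuousOn.comp continuousOn_snd fun p hp => hp.2) (fun _ _ => hg)
    exact this.comp (f := fun z => ((), z)) (by fun_prop) fun z hz => ⟨mem_univ _, hz⟩
  have h0 : (0 : ℝ) ∈ ball (0 : ℝ) δ := mem_ball_self hδ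
  -- The directional derivative along `v` is the parameter derivative at `s = 0` of the translates
  -- `g (w + s • v)`, so its holomorphy is an instance of the previous theorem.
  have key := hasDerivWithinAt_fderiv_of_hasDerivWithinAt (I := ball (0 : ℝ) δ)
    (V := ball z (r / 2)) (convex_ball _ _) isOpen_ball (h := fun s w => g (w + s • v))
    (h' := fun s w => fderiv ℂ g (w + s • v) v) (t := 0) (z := z)
    (fun s hs => hg.comp (by fun_prop) fun w hw => hin s hs w hw)
    (fun s hs w hw => by
      have h1 := ((hg.differentiableAt (hV.mem_nhds (hin s hs w hw))).hasFDerivAt.restrictScalars ℝ)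
      have h2 : HasDerivAt (fun s : ℝ => w + s • v) v s := by
        simpa using ((hasDerivAt_id s).smul_const v).const_add w
      exact (h1.comp_hasDerivAt s h2).hasDerivWithinAt)
    (by
      refine ContinuousOn.clm_apply (hcf.comp (by fun_prop) ?_) continuousOn_const
      rintro ⟨s, w⟩ ⟨hs, hw⟩
      exact hin s hs w hw)
    h0 (isOpen_ball.uniqueDiffWithinAt h0) (mem_ball_self (half_pos hr))
  simpa using key.1.differentiableWithinAt

/-- A holomorphic map on an open subset of a finite-dimensional space is `C^n`. -/
theorem contDiffOn_of_differentiableOn [FiniteDimensional ℂ E] [CompleteSpace F] {V : Set E}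
    (hV : IsOpen V) (n : ℕ) {g : E → F} (hg : DifferentiableOn ℂ g V) : ContDiffOn ℂ n g V := by
  induction n generalizing g with
  | zero => exact contDiffOn_zero.2 hg.continuousOn
  | succ n ih =>
    rw [Nat.cast_succ, contDiffOn_succ_iff_fderiv_of_isOpen hV]
    exact ⟨hg, fun h => absurd h (by simp), contDiffOn_clm_apply.2 fun v =>
      ih (differentiableOn_fderiv_apply hV hg v)⟩

/-- The integral of a continuous family of holomorphic maps is holomorphic. -/
theorem hasFDerivAt_integral_of_differentiableOn [FiniteDimensional ℂ E] [CompleteSpace F]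
    {a b : ℝ} {V : Set E} (hV : IsOpen V) {h : ℝ → E → F}
    (hc : ContinuousOn (Function.uncurry h) (uIcc a b ×ˢ V))
    (hd : ∀ t ∈ uIcc a b, DifferentiableOn ℂ (h t) V) {z : E} (hz : z ∈ V) :
    HasFDerivAt (fun w => ∫ t in a..b, h t w) (∫ t in a..b, fderiv ℂ (h t) z) z := by
  have : ProperSpace E := FiniteDimensional.proper ℂ E
  obtain ⟨R, hR, hRV⟩ := nhds_basis_closedBall.mem_iff.1 (hV.mem_nhds hz)
  have hcf := continuousOn_fderiv_of_differentiableOn hV hc hd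
  obtain ⟨C, hC⟩ := (isCompact_uIcc.prod (isCompact_closedBall z R)).exists_bound_of_continuousOn
    (hcf.mono (prod_mono_right hRV))
  have hsl : ∀ w ∈ V, ContinuousOn (fun t => h t w) (uIcc a b) := fun w hw =>
    hc.comp (f := fun t => (t, w)) (by fun_prop) fun t ht => ⟨ht, hw⟩
  have hslf : ContinuousOn (fun t => fderiv ℂ (h t) z) (uIcc a b) :=
    hcf.comp (f := fun t => (t, z)) (by fun_prop) fun t ht => ⟨ht, hz⟩
  refine intervalIntegral.hasFDerivAt_integral_of_dominated_of_fderiv_le (bound := fun _ => C)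
    (F := fun w t => h t w) (F' := fun w t => fderiv ℂ (h t) w)
    (closedBall_mem_nhds z hR) ?_ (hsl z hz).intervalIntegrable ?_ ?_ (by simp) ?_
  · filter_upwards [hV.mem_nhds hz] with w hw
    exact ((hsl w hw).mono uIoc_subset_uIcc).aestronglyMeasurable measurableSet_uIoc
  · exact (hslf.mono uIoc_subset_uIcc).aestronglyMeasurable measurableSet_uIoc
  · exact .of_forall fun t ht w hw => hC (t, w) ⟨uIoc_subset_uIcc ht, hw⟩
  · exact .of_forall fun t ht w hw => ((hd t (uIoc_subset_uIcc ht)).differentiableAt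
      (hV.mem_nhds (hRV hw))).hasFDerivAt

end Holomorphic

end HolSymp

namespace HolSymp

/-! ### The relative Poincaré lemma in a vector space -/

section Poincare

set_option maxSynthPendingDepth 3

open Metric Filter Topology

variable {E : Type*} [NormedAddCommGroup E] [NormedSpace ℂ E]

/-- The product rule for a complex-linear map applied to a vector, both depending on a real
parameter. -/
theorem hasDerivWithinAt_clm_apply {F G : Type*} [NormedAddCommGroup F] [NormedSpace ℂ F]
    [NormedAddCommGroup G] [NormedSpace ℂ G] {L : ℝ → F →L[ℂ] G} {L' : F →L[ℂ] G} {x : ℝ → F}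
    {x' : F} {I : Set ℝ} {t : ℝ} (hL : HasDerivWithinAt L L' I t)
    (hx : HasDerivWithinAt x x' I t) :
    HasDerivWithinAt (fun s => L s (x s)) (L t x' + L' (x t)) I t :=
  ((ContinuousLinearMap.id ℂ (F →L[ℂ] G)).bilinearRestrictScalars ℝ).hasDerivWithinAt_of_bilinear
    hL hx

/-- The bilinear-form version of closedness of a two-form at a point. -/
def IsClosedAt (B : E → E →L[ℂ] E →L[ℂ] ℂ) (z : E) : Prop :=
  ∀ a b c, fderiv ℂ B z a b c - fderiv ℂ B z b a c + fderiv ℂ B z c a b = 0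

/-- The one-form `∫₀¹ B_{g t z} (∂ₜ g t z, D (g t) z ·) dt` obtained from the family of two-forms
`B` and the homotopy `g` with velocity `g'`. -/
noncomputable def homotopyForm (B : E → E →L[ℂ] E →L[ℂ] ℂ) (g g' : ℝ → E → E) (z : E) :
    E →L[ℂ] ℂ :=
  ∫ t in (0 : ℝ)..1, (B (g t z) (g' t z)).comp (fderiv ℂ (g t) z)

/-- A continuously differentiable family `g t`, `0 ≤ t ≤ 1`, of holomorphic maps from `V` to `Ω`,
with velocity `g'`. -/
structure IsHolomorphicHomotopy (V Ω : Set E) (g g' : ℝ → E → E) : Prop where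
  mapsTo : ∀ t ∈ Icc (0 : ℝ) 1, MapsTo (g t) V Ω
  differentiableOn : ∀ t ∈ Icc (0 : ℝ) 1, DifferentiableOn ℂ (g t) V
  continuousOn : ContinuousOn (Function.uncurry g) (Icc (0 : ℝ) 1 ×ˢ V)
  hasDerivWithinAt : ∀ t ∈ Icc (0 : ℝ) 1, ∀ z ∈ V,
    HasDerivWithinAt (fun s => g s z) (g' t z) (Icc 0 1) t
  continuousOn_deriv : ContinuousOn (Function.uncurry g') (Icc (0 : ℝ) 1 ×ˢ V)

variable [FiniteDimensional ℂ E] {V Ω : Set E} {g g' : ℝ → E → E} {B : E → E →L[ℂ] E →L[ℂ] ℂ}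

theorem IsHolomorphicHomotopy.deriv_fderiv (hg : IsHolomorphicHomotopy V Ω g g') (hV : IsOpen V)
    {t : ℝ} (ht : t ∈ Icc (0 : ℝ) 1) {z : E} (hz : z ∈ V) :
    DifferentiableAt ℂ (g' t) z ∧
      HasDerivWithinAt (fun s => fderiv ℂ (g s) z) (fderiv ℂ (g' t) z) (Icc 0 1) t := by
  have : CompleteSpace E := FiniteDimensional.complete ℂ E
  exact hasDerivWithinAt_fderiv_of_hasDerivWithinAt (convex_Icc 0 1) hV hg.differentiableOn
    hg.hasDerivWithinAt hg.continuousOn_deriv ht (uniqueDiffOn_Icc zero_lt_one t ht) hz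

/-- Product rule for the three factors. The last term contains the second derivative of `g t`, which
is symmetric and therefore drops out under antisymmetrisation. -/
theorem IsHolomorphicHomotopy.hasFDerivAt_integrand (hg : IsHolomorphicHomotopy V Ω g g')
    (hV : IsOpen V) (hΩ : IsOpen Ω) (hB : DifferentiableOn ℂ B Ω)
    {t : ℝ} (ht : t ∈ Icc (0 : ℝ) 1) {z : E} (hz : z ∈ V) :
    ∃ L : E →L[ℂ] E →L[ℂ] ℂ, HasFDerivAt (fun z => (B (g t z) (g' t z)).comp (fderiv ℂ (g t) z)) L z ∧
      ∀ u v, L u v = fderiv ℂ B (g t z) (fderiv ℂ (g t) z u) (g' t z) (fderiv ℂ (g t) z v)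
        + B (g t z) (fderiv ℂ (g' t) z u) (fderiv ℂ (g t) z v)
        + B (g t z) (g' t z) (fderiv ℂ (fderiv ℂ (g t)) z u v) := by
  have : CompleteSpace E := FiniteDimensional.complete ℂ E
  have h1 := ((hg.differentiableOn t ht).differentiableAt (hV.mem_nhds hz)).hasFDerivAt
  have h2 := (hB.differentiableAt (hΩ.mem_nhds (hg.mapsTo t ht hz))).hasFDerivAt
  have h3 := (hg.deriv_fderiv hV ht hz).1.hasFDerivAt
  have h4 : DifferentiableAt ℂ (fderiv ℂ (g t)) z := by
    have := contDiffOn_of_differentiableOn hV 2 (hg.differentiableOn t ht)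
    have := ((contDiffOn_succ_iff_fderiv_of_isOpen (n := 1) hV).1 (by exact_mod_cast this)).2.2
    exact (this.differentiableOn one_ne_zero).differentiableAt (hV.mem_nhds hz)
  refine ⟨_, ((h2.comp z h1).clm_apply h3).clm_comp h4.hasFDerivAt, fun u v => ?_⟩
  simp
  ring

theorem IsHolomorphicHomotopy.continuousOn_integrand (hg : IsHolomorphicHomotopy V Ω g g')
    (hV : IsOpen V) (hB : DifferentiableOn ℂ B Ω) :
    ContinuousOn (Function.uncurry fun t z => (B (g t z) (g' t z)).comp (fderiv ℂ (g t) z))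
      (Icc (0 : ℝ) 1 ×ˢ V) := by
  refine ContinuousOn.clm_comp (ContinuousOn.clm_apply ?_ hg.continuousOn_deriv)
    (continuousOn_fderiv_of_differentiableOn hV hg.continuousOn hg.differentiableOn)
  exact hB.continuousOn.comp hg.continuousOn fun p hp => hg.mapsTo p.1 hp.1 hp.2

/-- Cartan's formula in coordinates: closedness and skewness of `B`, together with symmetry of
second derivatives, identify the `t`-derivative of the pull-back of `B` by `g t` with the exterior
derivative of the integrand. Integrating over `[0, 1]` leaves the two end values; the one at `0`
vanishes by `h0`, and the one at `1` is `B` itself because `g 1` is the identity. -/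
theorem IsHolomorphicHomotopy.homotopyForm_spec (hg : IsHolomorphicHomotopy V Ω g g')
    (hV : IsOpen V) (hΩ : IsOpen Ω) (hB : DifferentiableOn ℂ B Ω)
    (hskew : ∀ z ∈ Ω, ∀ u v, B z u v = -B z v u) (hclosed : ∀ z ∈ Ω, IsClosedAt B z)
    (h0 : ∀ z ∈ V, B (g 0 z) = 0) (h1 : ∀ z ∈ V, g 1 z = z) :
    DifferentiableOn ℂ (homotopyForm B g g') V ∧ ∀ z ∈ V, ∀ u v,
      fderiv ℂ (homotopyForm B g g') z u v - fderiv ℂ (homotopyForm B g g') z v u = B z u v := by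
  have : CompleteSpace E := FiniteDimensional.complete ℂ E
  set α : ℝ → E → E →L[ℂ] ℂ := fun t z => (B (g t z) (g' t z)).comp (fderiv ℂ (g t) z) with hα
  have hu : uIcc (0 : ℝ) 1 = Icc 0 1 := uIcc_of_le zero_le_one
  have hαc : ContinuousOn (Function.uncurry α) (Icc (0 : ℝ) 1 ×ˢ V) :=
    hg.continuousOn_integrand hV hB
  have hαd : ∀ t ∈ Icc (0 : ℝ) 1, DifferentiableOn ℂ (α t) V := fun t ht z hz => by
    obtain ⟨L, hL, -⟩ := hg.hasFDerivAt_integrand hV hΩ hB ht hz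
    exact hL.differentiableAt.differentiableWithinAt
  have hs : ∀ z ∈ V, HasFDerivAt (homotopyForm B g g') (∫ t in (0 : ℝ)..1, fderiv ℂ (α t) z) z :=
    fun z hz => hasFDerivAt_integral_of_differentiableOn hV (hu ▸ hαc) (hu ▸ hαd) hz
  refine ⟨fun z hz => (hs z hz).differentiableAt.differentiableWithinAt, fun z hz u v => ?_⟩
  have hαfc : ContinuousOn (fun t => fderiv ℂ (α t) z) (Icc 0 1) :=
    (continuousOn_fderiv_of_differentiableOn hV hαc hαd).comp (f := fun t => (t, z))
      (by fun_prop) fun t ht => ⟨ht, hz⟩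
  have hint : IntervalIntegrable (fun t => fderiv ℂ (α t) z) MeasureTheory.volume 0 1 :=
    (hu ▸ hαfc).intervalIntegrable
  have happ : ∀ u v, fderiv ℂ (homotopyForm B g g') z u v
      = ∫ t in (0 : ℝ)..1, fderiv ℂ (α t) z u v := fun u v => by
    rw [(hs z hz).fderiv, ContinuousLinearMap.intervalIntegral_apply hint,
      ContinuousLinearMap.intervalIntegral_apply
        (hu ▸ hαfc.clm_apply continuousOn_const).intervalIntegrable]
  have hcuv : ∀ u v, ContinuousOn (fun t => fderiv ℂ (α t) z u v) (Icc 0 1) := fun u v =>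
    (hαfc.clm_apply continuousOn_const).clm_apply continuousOn_const
  have hP : ∀ t ∈ Icc (0 : ℝ) 1, HasDerivWithinAt
      (fun t => B (g t z) (fderiv ℂ (g t) z u) (fderiv ℂ (g t) z v))
      (fderiv ℂ (α t) z u v - fderiv ℂ (α t) z v u) (Icc 0 1) t := fun t ht => by
    obtain ⟨L, hL, hLuv⟩ := hg.hasFDerivAt_integrand hV hΩ hB ht hz
    have hmem := hg.mapsTo t ht hz
    have e1 := (hB.differentiableAt (hΩ.mem_nhds hmem)).hasFDerivAt.restrictScalars ℝ
    have e2 := e1.comp_hasDerivWithinAt t (hg.hasDerivWithinAt t ht z hz)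
    have e3 := (hg.deriv_fderiv hV ht hz).2
    have ev : ∀ v, HasDerivWithinAt (fun s => fderiv ℂ (g s) z v) (fderiv ℂ (g' t) z v)
        (Icc 0 1) t := fun v =>
      (((ContinuousLinearMap.apply ℂ E v).restrictScalars ℝ).hasFDerivAt.comp_hasDerivWithinAt
        t e3)
    refine (hasDerivWithinAt_clm_apply (hasDerivWithinAt_clm_apply e2 (ev u)) (ev v)).congr_deriv ?_
    rw [hL.fderiv, hLuv, hLuv]
    have hsymm : fderiv ℂ (fderiv ℂ (g t)) z u v = fderiv ℂ (fderiv ℂ (g t)) z v u :=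
      (((contDiffOn_of_differentiableOn hV 2 (hg.differentiableOn t ht)).contDiffAt
        (hV.mem_nhds hz)).isSymmSndFDerivAt (by simp)) u v
    have hcl := hclosed _ hmem (g' t z) (fderiv ℂ (g t) z u) (fderiv ℂ (g t) z v)
    have hsk := hskew _ hmem (fderiv ℂ (g' t) z v) (fderiv ℂ (g t) z u)
    rw [hsymm]
    simp
    linear_combination hcl + hsk
  have key := intervalIntegral.integral_eq_sub_of_hasDerivAt_of_le zero_le_one
    (fun t ht => (hP t ht).continuousWithinAt)
    (fun t ht => (hP t (Ioo_subset_Icc_self ht)).hasDerivAt (Icc_mem_nhds ht.1 ht.2))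
    (hu ▸ ((hcuv u v).sub (hcuv v u))).intervalIntegrable
  rw [happ, happ, ← intervalIntegral.integral_sub (hu ▸ hcuv u v).intervalIntegrable
    (hu ▸ hcuv v u).intervalIntegrable, key]
  have hid : fderiv ℂ (g 1) z = ContinuousLinearMap.id ℂ E := by
    have : g 1 =ᶠ[𝓝 z] id := by filter_upwards [hV.mem_nhds hz] with w hw using h1 w hw
    rw [this.fderiv_eq, fderiv_id]
  rw [h0 z hz, h1 z hz, hid]
  simp

end Poincare

end HolSymp

namespace HolSymp

/-! ### Superposition operators on spaces of continuous functions -/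

section Nemytskii

set_option maxSynthPendingDepth 3

open Metric Filter Topology

variable {S : Type*} [TopologicalSpace S] {E : Type*} [NormedAddCommGroup E]
  {F : Type*} [NormedAddCommGroup F]

open Classical in
/-- The superposition operator `ξ ↦ (s ↦ v s (ξ s))`, with value zero where this is not
continuous. -/
noncomputable def nemytskii (v : S → E → F) (ξ : C(S, E)) : C(S, F) :=
  if h : Continuous fun s => v s (ξ s) then ⟨fun s => v s (ξ s), h⟩ else 0

theorem nemytskii_apply {Ω : Set E} {v : S → E → F}
    (hv : ContinuousOn (Function.uncurry v) (univ ×ˢ Ω)) {ξ : C(S, E)} (hξ : ∀ s, ξ s ∈ Ω) (s : S) :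
    nemytskii v ξ s = v s (ξ s) := by
  have h : Continuous fun s => v s (ξ s) :=
    hv.comp_continuous (f := fun s => (s, ξ s)) (by fun_prop) fun s => ⟨mem_univ _, hξ s⟩
  rw [nemytskii, dif_pos h]
  rfl

variable [CompactSpace S]

theorem isOpen_forall_mem {Ω : Set E} (hΩ : IsOpen Ω) : IsOpen {ξ : C(S, E) | ∀ s, ξ s ∈ Ω} := by
  have := ContinuousMap.isOpen_setOfPred_mapsTo (X := S) (K := univ) isCompact_univ hΩ
  simpa [MapsTo] using this

theorem continuousOn_nemytskii {Ω : Set E} {v : S → E → F}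
    (hv : ContinuousOn (Function.uncurry v) (univ ×ˢ Ω)) :
    ContinuousOn (nemytskii v) {ξ : C(S, E) | ∀ s, ξ s ∈ Ω} := by
  rw [continuousOn_iff_continuous_domRestrict]
  refine ContinuousMap.continuous_of_continuous_uncurry _ ?_
  have : Continuous fun p : {ξ : C(S, E) | ∀ s, ξ s ∈ Ω} × S =>
      Function.uncurry v (p.2, p.1.1 p.2) :=
    hv.comp_continuous (by fun_prop) fun p => ⟨mem_univ _, p.1.2 p.2⟩
  refine this.congr fun p => ?_
  exact (nemytskii_apply hv p.1.2 p.2).symm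

variable [NormedSpace ℂ E] [NormedSpace ℂ F]

/-- Pointwise application of a continuous family of continuous linear maps. -/
noncomputable def pointwiseApply : C(S, E →L[ℂ] F) →L[ℂ] C(S, E) →L[ℂ] C(S, F) :=
  LinearMap.mkContinuous₂
    (LinearMap.mk₂ ℂ (fun M ξ => (⟨fun s => M s (ξ s), by fun_prop⟩ : C(S, F)))
      (fun _ _ _ => by ext; simp) (fun _ _ _ => by ext; simp)
      (fun _ _ _ => by ext; simp) (fun _ _ _ => by ext; simp)) 1 fun M ξ => by
    rw [ContinuousMap.norm_le _ (by positivity)]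
    intro s
    rw [one_mul]
    exact ((M s).le_opNorm _).trans
      (mul_le_mul (M.norm_coe_le_norm s) (ξ.norm_coe_le_norm s) (norm_nonneg _) (norm_nonneg _))

@[simp]
theorem pointwiseApply_apply (M : C(S, E →L[ℂ] F)) (ξ : C(S, E)) (s : S) :
    pointwiseApply M ξ s = M s (ξ s) := rfl

/-- The remainder at each `s` is controlled by the mean value inequality on a ball about `ξ s`.
Compactness of `S` gives one radius that works for all `s`, so the pointwise bound is a bound in the
sup norm. -/
theorem hasFDerivAt_nemytskii {Ω : Set E} (hΩ : IsOpen Ω) {v : S → E → F}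
    (hv : ContinuousOn (Function.uncurry v) (univ ×ˢ Ω)) (hd : ∀ s, DifferentiableOn ℂ (v s) Ω)
    (hD : ContinuousOn (Function.uncurry fun s z => fderiv ℂ (v s) z) (univ ×ˢ Ω))
    {ξ : C(S, E)} (hξ : ∀ s, ξ s ∈ Ω) :
    HasFDerivAt (nemytskii v) (pointwiseApply (nemytskii (fun s z => fderiv ℂ (v s) z) ξ)) ξ := by
  rw [hasFDerivAt_iff_isLittleO, Asymptotics.isLittleO_iff]
  intro ε hε
  have hcont : Continuous fun q : E × S => ξ q.2 + q.1 := by fun_prop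
  have htube : ∀ᶠ u in 𝓝 (0 : E), ∀ s ∈ (univ : Set S), ξ s + u ∈ Ω ∧
      ‖fderiv ℂ (v s) (ξ s + u) - fderiv ℂ (v s) (ξ s)‖ < ε := by
    refine isCompact_univ.eventually_forall_of_forall_eventually fun s _ => ?_
    have h1 : ∀ᶠ q : E × S in 𝓝 (0, s), ξ q.2 + q.1 ∈ Ω :=
      hcont.continuousAt.eventually (hΩ.mem_nhds (by simpa using hξ s))
    have h2 : ContinuousAt (fun q : E × S => fderiv ℂ (v q.2) (ξ q.2 + q.1)
        - fderiv ℂ (v q.2) (ξ q.2)) (0, s) := by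
      refine ContinuousAt.sub ?_ ?_
      · exact ContinuousAt.comp (f := fun q : E × S => (q.2, ξ q.2 + q.1))
          (hD.continuousAt ((isOpen_univ.prod hΩ).mem_nhds ⟨mem_univ _, by simpa using hξ s⟩))
          (by fun_prop)
      · exact ContinuousAt.comp (f := fun q : E × S => (q.2, ξ q.2))
          (hD.continuousAt ((isOpen_univ.prod hΩ).mem_nhds ⟨mem_univ _, by simpa using hξ s⟩))
          (by fun_prop)
    have h3 := h2.norm.eventually_lt_const (u := ε) (by simpa using hε)
    filter_upwards [h1, h3] with q hq1 hq2 using ⟨hq1, hq2⟩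
  obtain ⟨δ, hδ, hball⟩ := Metric.eventually_nhds_iff_ball.1 htube
  filter_upwards [ball_mem_nhds ξ hδ, (isOpen_forall_mem hΩ).mem_nhds hξ] with ζ hζ hζΩ
  rw [ContinuousMap.norm_le _ (by positivity)]
  intro s
  have hin : ∀ z ∈ ball (ξ s) δ, z ∈ Ω ∧ ‖fderiv ℂ (v s) z - fderiv ℂ (v s) (ξ s)‖ < ε := by
    intro z hz
    have := hball (z - ξ s) (by simpa [dist_eq_norm] using hz) s (mem_univ _)
    simpa using this
  have key := (convex_ball (ξ s) δ).norm_image_sub_le_of_norm_hasFDerivWithin_le'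
    (f := v s) (f' := fderiv ℂ (v s)) (φ := fderiv ℂ (v s) (ξ s)) (C := ε) (x := ξ s) (y := ζ s)
    (fun z hz => (((hd s).differentiableAt
      (hΩ.mem_nhds (hin z hz).1)).hasFDerivAt).hasFDerivWithinAt)
    (fun z hz => (hin z hz).2.le) (mem_ball_self hδ)
    ((ContinuousMap.dist_apply_le_dist s).trans_lt hζ)
  simp only [ContinuousMap.sub_apply, pointwiseApply_apply]
  rw [nemytskii_apply hv hζΩ, nemytskii_apply hv hξ, nemytskii_apply hD hξ]
  exact key.trans (mul_le_mul_of_nonneg_left ((ζ - ξ).norm_coe_le_norm s) hε.le)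

end Nemytskii

/-! ### Volterra operators -/

section Volterra

set_option maxSynthPendingDepth 3

open Metric Filter Topology

variable {E : Type*} [NormedAddCommGroup E] [NormedSpace ℂ E] {a b : ℝ}

/-- The primitive vanishing at `0`, as an operator on continuous functions on `[a, b]`. -/
noncomputable def primitive (E : Type*) [NormedAddCommGroup E] [NormedSpace ℂ E] (hab : a ≤ b)
    (h0 : (0 : ℝ) ∈ Icc a b) : C(Icc a b, E) →L[ℂ] C(Icc a b, E) :=
  LinearMap.mkContinuous
    { toFun := fun ξ => ⟨fun t => ∫ s in (0 : ℝ)..t, IccExtend hab ξ s,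
        (intervalIntegral.continuous_primitive
          (fun _ _ => (ξ.continuous.Icc_extend' (h := hab)).intervalIntegrable _ _) 0).comp
          continuous_subtype_val⟩
      map_add' := fun ξ ζ => by
        ext t
        exact intervalIntegral.integral_add
          ((ξ.continuous.Icc_extend' (h := hab)).intervalIntegrable _ _)
          ((ζ.continuous.Icc_extend' (h := hab)).intervalIntegrable _ _)
      map_smul' := fun c ξ => by
        ext t
        exact intervalIntegral.integral_smul c _ } (b - a) fun ξ => by
    rw [ContinuousMap.norm_le _ (mul_nonneg (sub_nonneg.2 hab) (norm_nonneg _))]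
    intro t
    refine (intervalIntegral.norm_integral_le_of_norm_le_const (C := ‖ξ‖)
      fun s _ => ξ.norm_coe_le_norm _).trans ?_
    rw [mul_comm]
    refine mul_le_mul_of_nonneg_right ?_ (norm_nonneg _)
    rw [sub_zero, abs_le]
    constructor <;> linarith [h0.1, h0.2, t.2.1, t.2.2]

theorem primitive_apply (hab : a ≤ b) (h0 : (0 : ℝ) ∈ Icc a b) (ξ : C(Icc a b, E)) (t : Icc a b) :
    primitive E hab h0 ξ t = ∫ s in (0 : ℝ)..t, IccExtend hab ξ s := rfl

/-- Each further integration raises the power of `|t|` by one and divides by the new exponent, which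
builds up the factorial. The induction needs the bound pointwise in `t`; a sup-norm bound would only
give a geometric sequence. -/
theorem norm_primitive_pow_le (hab : a ≤ b) (h0 : (0 : ℝ) ∈ Icc a b)
    (M : C(Icc a b, E →L[ℂ] E)) (n : ℕ) (ξ : C(Icc a b, E)) (t : Icc a b) :
    ‖((primitive E hab h0 ∘L pointwiseApply M) ^ n) ξ t‖
      ≤ (‖M‖ * |(t : ℝ)|) ^ n / n.factorial * ‖ξ‖ := by
  induction n generalizing t with
  | zero => simpa using ξ.norm_coe_le_norm t
  | succ n ih =>
    rw [pow_succ', mul_apply_eq_comp, ContinuousLinearMap.comp_apply, primitive_apply]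
    have hb : ∀ s ∈ uIoc 0 (t : ℝ), ‖IccExtend hab (pointwiseApply M
        (((primitive E hab h0 ∘L pointwiseApply M) ^ n) ξ)) s‖
        ≤ (‖M‖ ^ (n + 1) / n.factorial * ‖ξ‖) * |s| ^ n := fun s hs => by
      have hs' : s ∈ Icc a b := by
        have := uIoc_subset_uIcc hs
        exact (ordConnected_Icc.uIcc_subset h0 t.2) this
      rw [IccExtend_of_mem hab _ hs', pointwiseApply_apply]
      calc _ ≤ ‖M ⟨s, hs'⟩‖ * ‖((primitive E hab h0 ∘L pointwiseApply M) ^ n) ξ ⟨s, hs'⟩‖ :=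
            (M ⟨s, hs'⟩).le_opNorm _
        _ ≤ ‖M‖ * ((‖M‖ * |s|) ^ n / n.factorial * ‖ξ‖) :=
            mul_le_mul (M.norm_coe_le_norm _) (ih ⟨s, hs'⟩) (norm_nonneg _) (norm_nonneg _)
        _ = _ := by rw [mul_pow]; ring
    have hint : ∫ s in uIoc 0 (t : ℝ), |s| ^ n = |(t : ℝ)| ^ (n + 1) / (n + 1) := by
      simpa using integral_pow_abs_sub_uIoc (a := 0) (b := (t : ℝ)) n
    refine (intervalIntegral.norm_integral_le_abs_of_norm_le
      ((MeasureTheory.ae_restrict_iff' measurableSet_uIoc).2 (.of_forall hb))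
      (by apply Continuous.intervalIntegrable; fun_prop)).trans ?_
    rw [intervalIntegral.integral_const_mul, abs_mul,
      intervalIntegral.abs_integral_eq_abs_integral_uIoc, hint, abs_of_nonneg (by positivity),
      abs_of_nonneg (by positivity), Nat.factorial_succ, mul_pow]
    push_cast
    apply le_of_eq
    field_simp

/-- By the factorial bound some power `T ^ n` has norm less than `1`, so `1 - T ^ n` is invertible;
it is the product of `1 - T` and a geometric sum commuting with it. This is the invertibility of the
linearised integral equation, with no smallness assumption on `M` or on the interval. -/
theorem isUnit_one_sub_primitive [CompleteSpace E] (hab : a ≤ b) (h0 : (0 : ℝ) ∈ Icc a b)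
    (M : C(Icc a b, E →L[ℂ] E)) :
    IsUnit (1 - primitive E hab h0 ∘L pointwiseApply M) := by
  set T := primitive E hab h0 ∘L pointwiseApply M with hT
  set R := max |a| |b|
  obtain ⟨n, hn⟩ := ((FloorSemiring.tendsto_pow_div_factorial_atTop
    (‖M‖ * R)).eventually_lt_const zero_lt_one).exists
  have hnorm : ‖T ^ n‖ < 1 := by
    refine (ContinuousLinearMap.opNorm_le_bound _ (by positivity) fun ξ => ?_).trans_lt hn
    rw [ContinuousMap.norm_le _ (by positivity)]
    intro t
    refine (norm_primitive_pow_le hab h0 M n ξ t).trans ?_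
    gcongr
    exact abs_le_max_abs_abs t.2.1 t.2.2
  have hu := isUnit_one_sub_of_norm_lt_one hnorm
  rw [← mul_neg_geom_sum] at hu
  refine (Commute.isUnit_mul_iff ?_).1 hu |>.1
  rw [Commute, SemiconjBy, mul_neg_geom_sum, geom_sum_mul_neg]

end Volterra

end HolSymp

namespace HolSymp

/-! ### Existence and holomorphic dependence of flows near a common zero -/

section Flow

set_option maxSynthPendingDepth 3

open Metric Filter Topology

variable {E : Type*} [NormedAddCommGroup E] [NormedSpace ℂ E] {a b : ℝ}

theorem hasDerivAt_IccExtend_of_eq_primitive [CompleteSpace E] (hab : a ≤ b)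
    (h0 : (0 : ℝ) ∈ Icc a b) {ξ η : C(Icc a b, E)} {c : E} (h : ∀ t, ξ t = c + primitive E hab h0 η t)
    {t : ℝ} (ht : t ∈ Ioo a b) : HasDerivAt (IccExtend hab ξ) (η ⟨t, Ioo_subset_Icc_self ht⟩) t := by
  have h1 : HasDerivAt (fun s => c + ∫ r in (0 : ℝ)..s, IccExtend hab η r) (IccExtend hab η t) t :=
    ((η.continuous.Icc_extend' (h := hab)).integral_hasStrictDerivAt 0 t).hasDerivAt.const_add c
  rw [IccExtend_of_mem hab _ (Ioo_subset_Icc_self ht)] at h1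
  refine h1.congr_of_eventuallyEq ?_
  filter_upwards [Ioo_mem_nhds ht.1 ht.2] with s hs
  rw [IccExtend_of_mem hab _ (Ioo_subset_Icc_self hs), h, primitive_apply]

variable [FiniteDimensional ℂ E]

/-- Near a common zero `p`, a continuous time-dependent holomorphic vector field `v` on
`[a, b] ∋ 0` has a flow which is defined for all times, holomorphic, and whose derivative satisfies
the variational equation. -/
theorem exists_holomorphic_flow (h0 : (0 : ℝ) ∈ Ioo a b) {Ω : Set E} (hΩ : IsOpen Ω)
    {v : ℝ → E → E} (hv : ContinuousOn (Function.uncurry v) (Icc a b ×ˢ Ω))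
    (hd : ∀ t ∈ Icc a b, DifferentiableOn ℂ (v t) Ω) {p : E} (hp : p ∈ Ω)
    (hvp : ∀ t ∈ Icc a b, v t p = 0) :
    ∃ ψ : ℝ → E → E, ∃ A : ℝ → E → E →L[ℂ] E, ∀ᶠ x in 𝓝 p, ψ 0 x = x ∧ A 0 x = .id ℂ E ∧
      ∀ t ∈ Ioo a b, ψ t x ∈ Ω ∧ HasDerivAt (fun s => ψ s x) (v t (ψ t x)) t ∧
        HasFDerivAt (ψ t) (A t x) x ∧
        ∀ h, HasDerivAt (fun s => A s x h) (fderiv ℂ (v t) (ψ t x) (A t x h)) t := by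
  have : CompleteSpace E := FiniteDimensional.complete ℂ E
  have hab : a ≤ b := (h0.1.trans h0.2).le
  have h0' : (0 : ℝ) ∈ Icc a b := Ioo_subset_Icc_self h0
  set w : Icc a b → E → E := fun s z => v s z
  have hw : ContinuousOn (Function.uncurry w) (univ ×ˢ Ω) :=
    hv.comp (f := fun q : Icc a b × E => ((q.1 : ℝ), q.2)) (by fun_prop)
      fun q hq => ⟨q.1.2, hq.2⟩
  have hwd : ∀ s, DifferentiableOn ℂ (w s) Ω := fun s => hd s s.2
  have hwD : ContinuousOn (Function.uncurry fun s z => fderiv ℂ (w s) z) (univ ×ˢ Ω) :=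
    continuousOn_fderiv_of_differentiableOn hΩ hw fun s _ => hwd s
  set J := primitive E hab h0'
  -- The integral curves starting at `x` are the solutions `ξ` of `H ξ = const x`. The inverse
  -- function theorem at the constant curve `p` produces them on all of `[a, b]` at once, depending
  -- holomorphically on `x`.
  set H : C(Icc a b, E) → C(Icc a b, E) := fun ξ => ξ - J (nemytskii w ξ) with hH
  set D : C(Icc a b, E) → C(Icc a b, E →L[ℂ] E) := nemytskii (fun s z => fderiv ℂ (w s) z)
  set U : Set C(Icc a b, E) := {ξ | ∀ s, ξ s ∈ Ω} with hU
  have hUo : IsOpen U := isOpen_forall_mem hΩ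
  have hHd : ∀ ξ ∈ U, HasFDerivAt H (1 - J ∘L pointwiseApply (D ξ)) ξ := fun ξ hξ =>
    (hasFDerivAt_id ξ).sub (J.hasFDerivAt.comp ξ (hasFDerivAt_nemytskii hΩ hw hwd hwD hξ))
  have hDc : ContinuousOn D U := continuousOn_nemytskii hwD
  set ι : E →L[ℂ] C(Icc a b, E) := ContinuousLinearMap.const ℂ _ with hι
  have hιp : ι p ∈ U := fun s => hp
  have hHC : ContDiffAt ℂ 1 H (ι p) := by
    refine contDiffAt_one_iff.2 ⟨_, U, hUo.mem_nhds hιp, ?_, hHd⟩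
    exact continuousOn_const.sub (continuousOn_const.clm_comp
      (pointwiseApply.continuous.comp_continuousOn hDc))
  have hnp : nemytskii w (ι p) = 0 := by
    ext s
    rw [nemytskii_apply hw hιp]
    exact hvp s s.2
  have hHp : H (ι p) = ι p := by simp [hH, hnp]
  set e := ContinuousLinearEquiv.unitsEquiv ℂ C(Icc a b, E)
    (isUnit_one_sub_primitive hab h0' (D (ι p))).unit
  have hH' : HasFDerivAt H (e : C(Icc a b, E) →L[ℂ] C(Icc a b, E)) (ι p) := hHd _ hιp
  set Φ := hHC.localInverse hH' one_ne_zero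
  have hΦ : ContDiffAt ℂ 1 Φ (ι p) := hHp ▸ hHC.to_localInverse hH' one_ne_zero
  have hΦp : Φ (ι p) = ι p := by
    conv_lhs => rw [← hHp]
    exact hHC.localInverse_apply_image hH' one_ne_zero
  have hright : ∀ᶠ ζ in 𝓝 (ι p), H (Φ ζ) = ζ := hHp ▸
    (hHC.hasStrictFDerivAt' hH' one_ne_zero).eventually_right_inverse
  have hιt : Tendsto ι (𝓝 p) (𝓝 (ι p)) := ι.continuous.tendsto p
  set Ψ : E → C(Icc a b, E) := fun x => Φ (ι x) with hΨ
  have hΨd : ∀ᶠ x in 𝓝 p, DifferentiableAt ℂ Ψ x := by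
    filter_upwards [hιt.eventually (hΦ.eventually (by simp))] with x hx
    exact (hx.differentiableAt one_ne_zero).comp x ι.differentiableAt
  have hΨU : ∀ᶠ x in 𝓝 p, Ψ x ∈ U :=
    (hΨd.self_of_nhds.continuousAt).eventually (hUo.mem_nhds (by rw [hΨ]; simpa [hΦp] using hιp))
  refine ⟨fun t x => IccExtend hab (Ψ x) t,
    fun t x => (ContinuousMap.evalCLM ℂ (projIcc a b hab t)) ∘L fderiv ℂ Ψ x, ?_⟩
  filter_upwards [hΨd, hΨU, (hιt.eventually hright).eventually_nhds] with x hx hxU hxH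
  have hξ : ∀ t, Ψ x t = x + J (nemytskii w (Ψ x)) t := fun t => by
    have h1 : Ψ x - J (nemytskii w (Ψ x)) = ι x := hxH.self_of_nhds
    have h2 := congrArg (fun ζ : C(Icc a b, E) => ζ t) h1
    exact sub_eq_iff_eq_add.1 h2
  -- Differentiating the identity `H (Ψ y) = ι y` in `y` gives the variational equation in
  -- integrated form.
  have hDξ : ∀ h t, fderiv ℂ Ψ x h t = h + J (pointwiseApply (D (Ψ x)) (fderiv ℂ Ψ x h)) t := by
    intro h t
    have h1 : HasFDerivAt (fun y => H (Ψ y)) _ x := (hHd _ hxU).comp x hx.hasFDerivAt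
    have h2 := (h1.congr_of_eventuallyEq (f₁ := ι)
      (hxH.mono fun y hy => hy.symm)).unique ι.hasFDerivAt
    have h3 := congrArg (fun L : E →L[ℂ] C(Icc a b, E) => L h t) h2
    exact sub_eq_iff_eq_add.1 h3
  have hJ0 : ∀ ζ, J ζ ⟨0, h0'⟩ = 0 := fun ζ => by simp [J, primitive_apply]
  refine ⟨?_, ?_, fun t ht => ?_⟩
  · rw [IccExtend_of_mem hab _ h0', hξ, hJ0, add_zero]
  · ext h
    simp only [ContinuousLinearMap.comp_apply, projIcc_of_mem hab h0']
    exact (hDξ h ⟨0, h0'⟩).trans (by rw [hJ0, add_zero]; rfl)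
  have ht' := Ioo_subset_Icc_self ht
  refine ⟨?_, ?_, ?_, fun h => ?_⟩
  · rw [IccExtend_of_mem hab _ ht']
    exact hxU _
  · refine (hasDerivAt_IccExtend_of_eq_primitive hab h0' hξ ht).congr_deriv ?_
    rw [nemytskii_apply hw hxU, IccExtend_of_mem hab _ ht']
  · exact (ContinuousMap.evalCLM ℂ (projIcc a b hab t)).hasFDerivAt.comp x hx.hasFDerivAt
  · refine (hasDerivAt_IccExtend_of_eq_primitive hab h0' (hDξ h) ht).congr_deriv ?_
    rw [pointwiseApply_apply, nemytskii_apply hwD hxU, IccExtend_of_mem hab _ ht']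
    simp only [ContinuousLinearMap.comp_apply, projIcc_of_mem hab ht']
    rfl

end Flow

end HolSymp

namespace HolSymp

/-! ### Moser's trick on an open subset of a vector space -/

section LocalMoser

set_option maxSynthPendingDepth 3

open Metric Filter Topology

variable {E : Type*} [NormedAddCommGroup E] [NormedSpace ℂ E]

/-- The segment of bilinear forms from `B₀` to `B₁`. -/
noncomputable def segmentForm {X : Type*} (B₀ B₁ : X → E →L[ℂ] E →L[ℂ] ℂ) (t : ℝ) (z : X) :
    E →L[ℂ] E →L[ℂ] ℂ :=
  B₀ z + (t : ℂ) • (B₁ z - B₀ z)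

/-- Data on an open set to which the Moser trick applies: two closed holomorphic two-forms
`B₀`, `B₁` with holomorphic primitive `s` of `B₁ - B₀` such that the segment between them consists
of nondegenerate forms. -/
structure IsMoserData (V : Set E) (B₀ B₁ : E → E →L[ℂ] E →L[ℂ] ℂ) (s : E → E →L[ℂ] ℂ) : Prop where
  isOpen : IsOpen V
  differentiableOn_zero : DifferentiableOn ℂ B₀ V
  differentiableOn_one : DifferentiableOn ℂ B₁ V
  skew_zero : ∀ z ∈ V, ∀ u w, B₀ z u w = -B₀ z w u
  skew_one : ∀ z ∈ V, ∀ u w, B₁ z u w = -B₁ z w u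
  closed_zero : ∀ z ∈ V, IsClosedAt B₀ z
  closed_one : ∀ z ∈ V, IsClosedAt B₁ z
  differentiableOn_primitive : DifferentiableOn ℂ s V
  deriv_primitive : ∀ z ∈ V, ∀ u w, fderiv ℂ s z u w - fderiv ℂ s z w u = B₁ z u w - B₀ z u w
  nondegenerate : ∀ t ∈ Icc (-1 : ℝ) 2, ∀ z ∈ V, ∀ u,
    (∀ w, segmentForm B₀ B₁ t z u w = 0) → u = 0

/-- The velocity `u` at the point `z` and time `t` solves Moser's equation. -/
def MoserEquation {X : Type*} (B₀ B₁ : X → E →L[ℂ] E →L[ℂ] ℂ) (s : X → E →L[ℂ] ℂ) (t : ℝ) (z : X)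
    (u : E) : Prop :=
  ∀ w, segmentForm B₀ B₁ t z u w = -s z w

/-- Moser's time-dependent vector field. -/
noncomputable def moserField (B₀ B₁ : E → E →L[ℂ] E →L[ℂ] ℂ) (s : E → E →L[ℂ] ℂ) (t : ℝ) (z : E) :
    E :=
  -ContinuousLinearMap.inverse (segmentForm B₀ B₁ t z) (s z)

/-- A nondegenerate bilinear form on a finite-dimensional space identifies it with its dual. -/
theorem exists_continuousLinearEquiv_of_nondegenerate [FiniteDimensional ℂ E]
    {b : E →L[ℂ] E →L[ℂ] ℂ}
    (hb : ∀ u, (∀ w, b u w = 0) → u = 0) : ∃ e : E ≃L[ℂ] (E →L[ℂ] ℂ), (e : E →L[ℂ] E →L[ℂ] ℂ) = b := by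
  have hinj : Function.Injective (b : E →ₗ[ℂ] E →L[ℂ] ℂ) := by
    rw [← LinearMap.ker_eq_bot, LinearMap.ker_eq_bot']
    intro u hu
    exact hb u fun w => by
      have := congrArg (fun L : E →L[ℂ] ℂ => L w) hu
      simpa using this
  have hdim : Module.finrank ℂ E = Module.finrank ℂ (E →L[ℂ] ℂ) := by
    rw [← (LinearMap.toContinuousLinearMap (𝕜 := ℂ) (E := E) (F' := ℂ)).finrank_eq]
    exact (Subspace.dual_finrank_eq (K := ℂ) (V := E)).symm
  refine ⟨(LinearMap.linearEquivOfInjective _ hinj hdim).toContinuousLinearEquiv, ?_⟩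
  ext u w
  rfl

/-- Nondegeneracy of the whole segment is an open condition. -/
theorem eventually_segmentForm_nondegenerate [FiniteDimensional ℂ E]
    {B₀ B₁ : E → E →L[ℂ] E →L[ℂ] ℂ} {p : E} (h₀ : ContinuousAt B₀ p) (h₁ : ContinuousAt B₁ p)
    {T : Set ℝ} (hT : IsCompact T) (hp : ∀ t ∈ T, ∀ u, (∀ w, segmentForm B₀ B₁ t p u w = 0) → u = 0) :
    ∀ᶠ z in 𝓝 p, ∀ t ∈ T, ∀ u, (∀ w, segmentForm B₀ B₁ t z u w = 0) → u = 0 := by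
  have : CompleteSpace E := FiniteDimensional.complete ℂ E
  refine hT.eventually_forall_of_forall_eventually fun t ht => ?_
  obtain ⟨e, he⟩ := exists_continuousLinearEquiv_of_nondegenerate (hp t ht)
  have hc : ContinuousAt (fun q : E × ℝ => segmentForm B₀ B₁ q.2 q.1) (p, t) := by
    have e0 : ContinuousAt (fun q : E × ℝ => B₀ q.1) (p, t) := h₀.comp continuousAt_fst
    have e1 : ContinuousAt (fun q : E × ℝ => B₁ q.1) (p, t) := h₁.comp continuousAt_fst
    have e2 : ContinuousAt (fun q : E × ℝ => (q.2 : ℂ)) (p, t) := by fun_prop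
    exact e0.add (e2.smul (e1.sub e0))
  -- The invertible operators form a neighbourhood of `e`.
  filter_upwards [hc.eventually (he ▸ e.nhds)] with q hq
  obtain ⟨e', he'⟩ := hq
  intro u hu
  refine e'.map_eq_zero_iff.1 ?_
  ext w
  simpa [← he'] using hu w

variable {V : Set E} {B₀ B₁ : E → E →L[ℂ] E →L[ℂ] ℂ} {s : E → E →L[ℂ] ℂ}

theorem IsMoserData.differentiableOn_segmentForm (h : IsMoserData V B₀ B₁ s) (t : ℝ) :
    DifferentiableOn ℂ (segmentForm B₀ B₁ t) V :=
  show DifferentiableOn ℂ (B₀ + (t : ℂ) • (B₁ - B₀)) V from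
    h.differentiableOn_zero.add ((h.differentiableOn_one.sub h.differentiableOn_zero).const_smul _)

theorem IsMoserData.skew_segmentForm (h : IsMoserData V B₀ B₁ s) (t : ℝ) {z : E} (hz : z ∈ V)
    (u w : E) : segmentForm B₀ B₁ t z u w = -segmentForm B₀ B₁ t z w u := by
  simp only [segmentForm, add_apply, smul_apply,
    sub_apply, smul_eq_mul]
  linear_combination (1 - (t : ℂ)) * h.skew_zero z hz u w + (t : ℂ) * h.skew_one z hz u w

theorem IsMoserData.fderiv_segmentForm (h : IsMoserData V B₀ B₁ s) (t : ℝ) {z : E} (hz : z ∈ V) :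
    fderiv ℂ (segmentForm B₀ B₁ t) z
      = fderiv ℂ B₀ z + (t : ℂ) • (fderiv ℂ B₁ z - fderiv ℂ B₀ z) := by
  have h0 := (h.differentiableOn_zero.differentiableAt (h.isOpen.mem_nhds hz)).hasFDerivAt
  have h1 := (h.differentiableOn_one.differentiableAt (h.isOpen.mem_nhds hz)).hasFDerivAt
  exact (h0.add ((h1.sub h0).const_smul (t : ℂ))).fderiv

theorem IsMoserData.isClosedAt_segmentForm (h : IsMoserData V B₀ B₁ s) (t : ℝ) {z : E}
    (hz : z ∈ V) : IsClosedAt (segmentForm B₀ B₁ t) z := by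
  intro a b c
  rw [h.fderiv_segmentForm t hz]
  simp only [add_apply, smul_apply,
    sub_apply, smul_eq_mul]
  linear_combination (1 - (t : ℂ)) * h.closed_zero z hz a b c + (t : ℂ) * h.closed_one z hz a b c

variable [FiniteDimensional ℂ E]

theorem IsMoserData.exists_equiv (h : IsMoserData V B₀ B₁ s) {t : ℝ} (ht : t ∈ Icc (-1 : ℝ) 2)
    {z : E} (hz : z ∈ V) :
    ∃ e : E ≃L[ℂ] (E →L[ℂ] ℂ), (e : E →L[ℂ] E →L[ℂ] ℂ) = segmentForm B₀ B₁ t z :=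
  exists_continuousLinearEquiv_of_nondegenerate (h.nondegenerate t ht z hz)

/-- Nondegeneracy makes the solution unique. The relation is what transports along charts and
symmetries; the explicit field is what the theory of differential equations takes as input. -/
theorem IsMoserData.moserEquation_iff (h : IsMoserData V B₀ B₁ s) {t : ℝ}
    (ht : t ∈ Icc (-1 : ℝ) 2) {z u : E} (hz : z ∈ V) :
    MoserEquation B₀ B₁ s t z u ↔ u = moserField B₀ B₁ s t z := by
  obtain ⟨e, he⟩ := h.exists_equiv ht hz
  rw [moserField, ← he, ContinuousLinearMap.inverse_equiv, ← map_neg, MoserEquation, ← he]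
  constructor
  · intro hu
    refine (e.symm_apply_eq.2 ?_).symm
    ext w
    exact (hu w).symm
  · rintro rfl w
    simp

theorem IsMoserData.differentiableOn_moserField (h : IsMoserData V B₀ B₁ s) {t : ℝ}
    (ht : t ∈ Icc (-1 : ℝ) 2) : DifferentiableOn ℂ (moserField B₀ B₁ s t) V := by
  have : CompleteSpace E := FiniteDimensional.complete ℂ E
  intro z hz
  obtain ⟨e, he⟩ := h.exists_equiv ht hz
  have h1 : DifferentiableAt ℂ (ContinuousLinearMap.inverse (R := ℂ))
      (segmentForm B₀ B₁ t z) := he ▸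
    ((contDiffAt_map_inverse e (n := 1)).differentiableAt one_ne_zero)
  exact ((h1.comp_differentiableWithinAt z (h.differentiableOn_segmentForm t z hz)).clm_apply
    (h.differentiableOn_primitive z hz)).neg

theorem IsMoserData.continuousOn_moserField (h : IsMoserData V B₀ B₁ s) :
    ContinuousOn (Function.uncurry (moserField B₀ B₁ s)) (Icc (-1 : ℝ) 2 ×ˢ V) := by
  have : CompleteSpace E := FiniteDimensional.complete ℂ E
  rintro ⟨t, z⟩ ⟨ht, hz⟩
  obtain ⟨e, he⟩ := h.exists_equiv ht hz
  have h1 : ContinuousAt (ContinuousLinearMap.inverse (R := ℂ)) (segmentForm B₀ B₁ t z) := he ▸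
    ((contDiffAt_map_inverse e (n := 1)).continuousAt)
  have hsnd : ∀ {G : Type _} [TopologicalSpace G] {f : E → G}, ContinuousOn f V →
      ContinuousWithinAt (fun q : ℝ × E => f q.2) (Icc (-1 : ℝ) 2 ×ˢ V) (t, z) := fun hf =>
    ContinuousWithinAt.comp (t := V) (hf z hz) continuousWithinAt_snd fun q hq => hq.2
  have h2 : ContinuousWithinAt (fun q : ℝ × E => segmentForm B₀ B₁ q.1 q.2)
      (Icc (-1 : ℝ) 2 ×ˢ V) (t, z) :=
    (hsnd h.differentiableOn_zero.continuousOn).add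
      ((Complex.continuous_ofReal.continuousAt.comp_continuousWithinAt
        continuousWithinAt_fst).smul ((hsnd h.differentiableOn_one.continuousOn).sub
          (hsnd h.differentiableOn_zero.continuousOn)))
  exact (ContinuousWithinAt.clm_apply (h1.comp_continuousWithinAt (f := fun q : ℝ × E =>
    segmentForm B₀ B₁ q.1 q.2) (x := (t, z)) h2)
    (hsnd h.differentiableOn_primitive.continuousOn)).neg

/-- The infinitesimal form of Moser's identity: the Lie derivative of `B_t` along the Moser field
cancels the time derivative of `B_t`. -/
theorem IsMoserData.lieDeriv_add_eq_zero (h : IsMoserData V B₀ B₁ s) {t : ℝ}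
    (ht : t ∈ Icc (-1 : ℝ) 2) {z : E} (hz : z ∈ V) (u w : E) :
    fderiv ℂ (segmentForm B₀ B₁ t) z (moserField B₀ B₁ s t z) u w + (B₁ z - B₀ z) u w
      + segmentForm B₀ B₁ t z (fderiv ℂ (moserField B₀ B₁ s t) z u) w
      + segmentForm B₀ B₁ t z u (fderiv ℂ (moserField B₀ B₁ s t) z w) = 0 := by
  have hV := h.isOpen.mem_nhds hz
  have hB := ((h.differentiableOn_segmentForm t).differentiableAt hV).hasFDerivAt
  have hv := ((h.differentiableOn_moserField ht).differentiableAt hV).hasFDerivAt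
  have hs := (h.differentiableOn_primitive.differentiableAt hV).hasFDerivAt
  -- The defining equation holds on a neighbourhood of `z`, so it can be differentiated.
  -- Antisymmetrising the result expresses `d(ι_v B_t) = -ds = B₀ - B₁`, and closedness of `B_t`
  -- supplies the rest of the Lie derivative.
  have heq : (fun z => segmentForm B₀ B₁ t z (moserField B₀ B₁ s t z)) =ᶠ[𝓝 z] fun z => -s z := by
    filter_upwards [hV] with y hy
    ext w
    exact (h.moserEquation_iff ht hy).2 rfl w
  have key := ((hB.clm_apply hv).congr_of_eventuallyEq heq.symm).unique hs.neg
  have huw := congrArg (fun L : E →L[ℂ] E →L[ℂ] ℂ => L u w) key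
  have hwu := congrArg (fun L : E →L[ℂ] E →L[ℂ] ℂ => L w u) key
  simp at huw hwu
  have h1 := h.isClosedAt_segmentForm t hz (moserField B₀ B₁ s t z) u w
  have h2 := h.skew_segmentForm t hz u (fderiv ℂ (moserField B₀ B₁ s t) z w)
  have h3 := h.deriv_primitive z hz u w
  simp only [sub_apply]
  linear_combination h1 + h2 + huw - hwu - h3

/-- Two curves solving Moser's equation near `t₀` which agree at `t₀` agree near `t₀`. -/
theorem IsMoserData.eventuallyEq_of_moserEquation (h : IsMoserData V B₀ B₁ s) {t₀ : ℝ}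
    (ht₀ : t₀ ∈ Ioo (-1 : ℝ) 2) {c d : ℝ → E}
    (hc : ∀ᶠ t in 𝓝 t₀, c t ∈ V ∧ ∃ u, HasDerivAt c u t ∧ MoserEquation B₀ B₁ s t (c t) u)
    (hd : ∀ᶠ t in 𝓝 t₀, d t ∈ V ∧ ∃ u, HasDerivAt d u t ∧ MoserEquation B₀ B₁ s t (d t) u)
    (hcd : c t₀ = d t₀) : c =ᶠ[𝓝 t₀] d := by
  have hV := hc.self_of_nhds.1
  have hD := continuousOn_fderiv_of_differentiableOn h.isOpen h.continuousOn_moserField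
    fun t ht => h.differentiableOn_moserField ht
  have hca : ContinuousAt (fun p : ℝ × E => fderiv ℂ (moserField B₀ B₁ s p.1) p.2) (t₀, c t₀) :=
    hD.continuousAt (prod_mem_nhds (Icc_mem_nhds ht₀.1 ht₀.2) (h.isOpen.mem_nhds hV))
  -- By continuity `K` bounds the derivative near `(t₀, c t₀)`; it serves as the Lipschitz constant,
  -- uniformly in time, on a small ball.
  set K : ℝ := ‖fderiv ℂ (moserField B₀ B₁ s t₀) (c t₀)‖ + 1
  have hK : 0 ≤ K := by positivity
  have hbd : ∀ᶠ p : ℝ × E in 𝓝 (t₀, c t₀), ‖fderiv ℂ (moserField B₀ B₁ s p.1) p.2‖ < K :=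
    hca.norm.eventually_lt_const (lt_add_one _)
  have hbd' : ∀ᶠ p : ℝ × E in 𝓝 t₀ ×ˢ 𝓝 (c t₀), ‖fderiv ℂ (moserField B₀ B₁ s p.1) p.2‖ < K ∧
      p.1 ∈ Ioo (-1 : ℝ) 2 ∧ p.2 ∈ V := by
    rw [← nhds_prod_eq]
    exact hbd.and (prod_mem_nhds (Ioo_mem_nhds ht₀.1 ht₀.2) (h.isOpen.mem_nhds hV))
  obtain ⟨P, hP, Q, hQ, hPQ⟩ := eventually_prod_iff.1 hbd'
  obtain ⟨ε, hε, hεQ⟩ := Metric.eventually_nhds_iff_ball.1 hQ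
  have hball : ball (c t₀) ε ∈ 𝓝 (c t₀) := ball_mem_nhds _ hε
  have hsol : ∀ {c' : ℝ → E}, (∀ᶠ t in 𝓝 t₀, c' t ∈ V ∧ ∃ u, HasDerivAt c' u t ∧
      MoserEquation B₀ B₁ s t (c' t) u) → c' t₀ = c t₀ →
      ∀ᶠ t in 𝓝 t₀, HasDerivAt c' (moserField B₀ B₁ s t (c' t)) t ∧ c' t ∈ ball (c t₀) ε := by
    intro c' hc' h0
    obtain ⟨-, u₀, hu₀, -⟩ := hc'.self_of_nhds
    filter_upwards [hc', Icc_mem_nhds ht₀.1 ht₀.2,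
      hu₀.continuousAt.eventually (h0 ▸ hball)] with t ⟨ht, u, hu, hm⟩ htI htb
    exact ⟨((h.moserEquation_iff htI ht).1 hm) ▸ hu, h0 ▸ htb⟩
  refine ODE_solution_unique_of_eventually (v := moserField B₀ B₁ s) (K := ⟨K, hK⟩)
    (s := fun _ => ball (c t₀) ε) ?_ (hsol hc rfl) (hsol hd hcd.symm) hcd
  filter_upwards [hP] with t ht
  refine (convex_ball (c t₀) ε).lipschitzOnWith_of_nnnorm_fderiv_le (𝕜 := ℂ) (fun z hz => ?_)
    fun z hz => ?_
  · have := hPQ ht (hεQ z hz)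
    exact (h.differentiableOn_moserField (Ioo_subset_Icc_self this.2.1)).differentiableAt
      (h.isOpen.mem_nhds this.2.2)
  · exact (hPQ ht (hεQ z hz)).1.le

/-- The local Moser trick: near a zero `p` of the primitive, the time-one map of the flow of the
Moser field pulls `B₁` back to `B₀`. -/
theorem IsMoserData.exists_flow (h : IsMoserData V B₀ B₁ s) {p : E} (hp : p ∈ V) (hsp : s p = 0) :
    ∃ ψ : ℝ → E → E, ∀ᶠ x in 𝓝 p, ψ 0 x = x ∧
      (∀ t ∈ Ioo (-1 : ℝ) 2, ψ t x ∈ V ∧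
        ∃ u, HasDerivAt (fun τ => ψ τ x) u t ∧ MoserEquation B₀ B₁ s t (ψ t x) u) ∧
      DifferentiableAt ℂ (ψ 1) x ∧
      ∀ u w, B₁ (ψ 1 x) (fderiv ℂ (ψ 1) x u) (fderiv ℂ (ψ 1) x w) = B₀ x u w := by
  have hJ : Ioo (-1 : ℝ) 2 ⊆ Icc (-1) 2 := Ioo_subset_Icc_self
  obtain ⟨ψ, A, hψ⟩ := exists_holomorphic_flow (a := -1) (b := 2) (by norm_num) h.isOpen
    h.continuousOn_moserField (fun t ht => h.differentiableOn_moserField ht) hp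
    (fun t ht => by simp [moserField, hsp])
  refine ⟨ψ, hψ.mono fun x ⟨h0, hA0, hx⟩ => ⟨h0, fun t ht => ?_, ?_, fun u w => ?_⟩⟩
  · obtain ⟨h1, h2, -⟩ := hx t ht
    exact ⟨h1, _, h2, (h.moserEquation_iff (hJ ht) h1).2 rfl⟩
  · exact (hx 1 (by norm_num)).2.2.1.differentiableAt
  · rw [(hx 1 (by norm_num)).2.2.1.fderiv]
    -- `Q` is the pull-back of `B_t` by the flow, evaluated on `u` and `w`. Its derivative is the
    -- expression in `lieDeriv_add_eq_zero`, so `Q 0` and `Q 1` agree.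
    set Q : ℝ → ℂ := fun t => segmentForm B₀ B₁ t (ψ t x) (A t x u) (A t x w) with hQ
    have hQd : ∀ t ∈ Ioo (-1 : ℝ) 2, ∀ I, HasDerivWithinAt Q 0 I t := by
      intro t ht I
      obtain ⟨hV, hd, -, hA⟩ := hx t ht
      have hn := h.isOpen.mem_nhds hV
      have e0 := (((h.differentiableOn_zero.differentiableAt hn).hasFDerivAt.restrictScalars
        ℝ).comp_hasDerivAt t hd).hasDerivWithinAt (s := I)
      have e1 := (((h.differentiableOn_one.differentiableAt hn).hasFDerivAt.restrictScalars
        ℝ).comp_hasDerivAt t hd).hasDerivWithinAt (s := I)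
      have et : HasDerivWithinAt (fun r : ℝ => (r : ℂ)) 1 I t :=
        (Complex.ofRealCLM.hasDerivAt (x := t)).hasDerivWithinAt
      have eB := e0.add (et.smul (e1.sub e0))
      have := hasDerivWithinAt_clm_apply (hasDerivWithinAt_clm_apply eB
        (hA u).hasDerivWithinAt) (hA w).hasDerivWithinAt
      refine this.congr_deriv ?_
      have key := h.lieDeriv_add_eq_zero (hJ ht) hV (A t x u) (A t x w)
      rw [h.fderiv_segmentForm t hV] at key
      simp [segmentForm] at key ⊢
      linear_combination key
    have hI : ∀ t ∈ Icc (0 : ℝ) 1, t ∈ Ioo (-1 : ℝ) 2 := fun t ht =>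
      ⟨by linarith [ht.1], by linarith [ht.2]⟩
    have := constant_of_has_deriv_right_zero (f := Q) (a := 0) (b := 1)
      (fun t ht => (hQd t (hI t ht) _).continuousWithinAt)
      (fun t ht => hQd t (hI t (Ico_subset_Icc_self ht)) _) 1 (by norm_num)
    simpa [hQ, segmentForm, h0, hA0] using this

end LocalMoser

end HolSymp

namespace HolSymp

/-! ### Two-forms, derivatives and velocities on the manifold -/

section Tangent

set_option maxSynthPendingDepth 3

open Metric Filter Topology

variable {E : Type*} [NormedAddCommGroup E] [NormedSpace ℂ E]

/-- A two-form on a vector space as a bilinear map. -/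
noncomputable def toBilin (E : Type*) [NormedAddCommGroup E] [NormedSpace ℂ E] :
    (E [⋀^Fin 2]→L[ℂ] ℂ) →L[ℂ] E →L[ℂ] E →L[ℂ] ℂ :=
  (((ContinuousAlternatingMap.ofSubsingletonLIE (𝕜 := ℂ) (E := E) (F := ℂ)
    (0 : Fin 1)).symm.toContinuousLinearEquiv : _ →L[ℂ] E →L[ℂ] ℂ).postcomp E) ∘L
    (ContinuousAlternatingMap.curryLeftLI (𝕜 := ℂ) (E := E) (F := ℂ)
      (n := 1)).toContinuousLinearMap

theorem toBilin_apply (β : E [⋀^Fin 2]→L[ℂ] ℂ) (u v : E) : toBilin E β u v = β ![u, v] := by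
  have h : ∀ L : E [⋀^Fin 1]→L[ℂ] ℂ,
      (ContinuousAlternatingMap.ofSubsingletonLIE (𝕜 := ℂ) (E := E) (F := ℂ)
        (0 : Fin 1)).symm L v = L ![v] := fun L => by
    obtain ⟨l, rfl⟩ := (ContinuousAlternatingMap.ofSubsingletonLIE (𝕜 := ℂ) (E := E) (F := ℂ)
        (0 : Fin 1)).surjective L
    rw [LinearIsometryEquiv.symm_apply_apply]
    rfl
  exact h _

theorem toBilin_skew (β : E [⋀^Fin 2]→L[ℂ] ℂ) (u v : E) :
    toBilin E β u v = -toBilin E β v u := by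
  rw [toBilin_apply, toBilin_apply]
  have := β.map_swap ![v, u] (i := 0) (j := 1) (by simp)
  have hs : ![v, u] ∘ Equiv.swap (0 : Fin 2) 1 = ![u, v] := by
    ext i
    fin_cases i <;> simp
  rw [hs] at this
  exact this

/-- The alternating sum over the three omitted indices that defines `extDeriv` is, term by term, the
expression in `IsClosedAt`. -/
theorem isClosedAt_toBilin {β : E → E [⋀^Fin 2]→L[ℂ] ℂ} {z : E} (hβ : DifferentiableAt ℂ β z)
    (hc : extDeriv β z = 0) : IsClosedAt (fun z => toBilin E (β z)) z := by
  intro a b c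
  have h1 : HasFDerivAt (fun z => toBilin E (β z)) ((toBilin E) ∘L fderiv ℂ β z) z :=
    (toBilin E).hasFDerivAt.comp z hβ.hasFDerivAt
  have h2 : ∀ (m : Fin 2 → E) (u : E), fderiv ℂ (fun x => β x m) z u = fderiv ℂ β z u m := by
    intro m u
    rw [fderiv_continuousAlternatingMap_apply_const_apply hβ]
  have h3 := congrArg (fun L : E [⋀^Fin 3]→L[ℂ] ℂ => L ![a, b, c]) hc
  simp only [extDeriv_apply hβ, h2] at h3
  rw [h1.fderiv]
  have h4 : ∀ a b c, (toBilin E ∘L fderiv ℂ β z) a b c = fderiv ℂ β z a ![b, c] :=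
    fun _ _ _ => toBilin_apply _ _ _
  rw [h4, h4, h4]
  have e0 : Fin.removeNth (0 : Fin 3) ![a, b, c] = ![b, c] := by
    ext i; fin_cases i <;> rfl
  have e1 : Fin.removeNth (1 : Fin 3) ![a, b, c] = ![a, c] := by
    ext i; fin_cases i <;> rfl
  have e2 : Fin.removeNth (2 : Fin 3) ![a, b, c] = ![a, b] := by
    ext i; fin_cases i <;> rfl
  rw [Fin.sum_univ_succ, Fin.sum_univ_two] at h3
  change (-1 : ℤ) ^ 0 • fderiv ℂ β z a (Fin.removeNth (0 : Fin 3) ![a, b, c])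
    + ((-1 : ℤ) ^ 1 • fderiv ℂ β z b (Fin.removeNth (1 : Fin 3) ![a, b, c])
    + (-1 : ℤ) ^ 2 • fderiv ℂ β z c (Fin.removeNth (2 : Fin 3) ![a, b, c])) = 0 at h3
  rw [e0, e1, e2, pow_zero, one_smul, pow_one, neg_smul, one_smul, neg_one_sq, one_smul] at h3
  linear_combination h3

variable {M : Type*} [TopologicalSpace M] [ChartedSpace E M]
  {N : Type*} [TopologicalSpace N] [ChartedSpace E N]
  {P : Type*} [TopologicalSpace P] [ChartedSpace E P]

/-- A two-form at a point, as a bilinear form on the model space. -/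
noncomputable def bilin (η : TwoForm E M) (x : M) : E →L[ℂ] E →L[ℂ] ℂ := toBilin E (η x)

/-- The manifold derivative as a linear endomorphism of the model space. -/
noncomputable def tder (E : Type*) [NormedAddCommGroup E] [NormedSpace ℂ E]
    {M : Type*} [TopologicalSpace M] [ChartedSpace E M]
    {N : Type*} [TopologicalSpace N] [ChartedSpace E N] (f : M → N) (x : M) : E →L[ℂ] E :=
  mfderiv 𝓘(ℂ, E) 𝓘(ℂ, E) f x

theorem bilin_pullback (f : M → N) (η : TwoForm E N) (x : M) (u v : E) :
    bilin (pullback f η) x u v = bilin η (f x) (tder E f x u) (tder E f x v) := by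
  refine (toBilin_apply _ u v).trans (Eq.trans ?_ (toBilin_apply _ _ _).symm)
  refine congrArg (η (f x)) (funext fun i => ?_)
  fin_cases i <;> rfl

theorem tder_comp {g : N → P} {f : M → N} {x : M} (hg : MDifferentiableAt 𝓘(ℂ, E) 𝓘(ℂ, E) g (f x))
    (hf : MDifferentiableAt 𝓘(ℂ, E) 𝓘(ℂ, E) f x) :
    tder E (g ∘ f) x = (tder E g (f x)).comp (tder E f x) :=
  mfderiv_comp x hg hf

theorem tder_id (x : M) : tder E (id : M → M) x = .id ℂ E := mfderiv_id

theorem tder_congr {f g : M → N} {x : M} (h : f =ᶠ[𝓝 x] g) : tder E f x = tder E g x :=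
  h.mfderiv_eq

theorem tder_eq_fderiv (f : E → E) (x : E) : tder E f x = fderiv ℂ f x := mfderiv_eq_fderiv

/-- The curve `γ` has velocity `v` at `t` within `I`. -/
def HasVelocityWithinAt (γ : ℝ → M) (v : E) (I : Set ℝ) (t : ℝ) : Prop :=
  ContinuousWithinAt γ I t ∧ HasDerivWithinAt (fun s => chartAt E (γ t) (γ s)) v I t

theorem hasVelocityWithinAt_iff_hasDerivWithinAt {c : ℝ → E} {v : E} {I : Set ℝ} {t : ℝ} :
    HasVelocityWithinAt c v I t ↔ HasDerivWithinAt c v I t :=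
  ⟨fun h => h.2, fun h => ⟨h.continuousWithinAt, h⟩⟩

theorem HasVelocityWithinAt.comp {f : M → N} {γ : ℝ → M} {v : E} {I : Set ℝ} {t : ℝ}
    (hf : MDifferentiableAt 𝓘(ℂ, E) 𝓘(ℂ, E) f (γ t)) (hγ : HasVelocityWithinAt γ v I t) :
    HasVelocityWithinAt (f ∘ γ) (tder E f (γ t) v) I t := by
  obtain ⟨h1, h2⟩ := hf.hasMFDerivAt
  refine ⟨h1.comp_continuousWithinAt hγ.1, ?_⟩
  have h3 : HasFDerivWithinAt (writtenInExtChartAt 𝓘(ℂ, E) 𝓘(ℂ, E) (γ t) f) (tder E f (γ t))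
    (range 𝓘(ℂ, E)) (chartAt E (γ t) (γ t)) := h2
  rw [modelWithCornersSelf_coe, range_id, hasFDerivWithinAt_univ] at h3
  have h4 := (h3.restrictScalars ℝ).comp_hasDerivWithinAt t hγ.2
  refine h4.congr_of_eventuallyEq ?_ ?_
  · filter_upwards [hγ.1.eventually ((chartAt E (γ t)).open_source.mem_nhds
      (mem_chart_source E (γ t)))] with s hs
    simp [writtenInExtChartAt, (chartAt E (γ t)).left_inv hs]
  · simp [writtenInExtChartAt]

theorem HasVelocityWithinAt.congr_of_eventuallyEq {γ δ : ℝ → M} {v : E} {I : Set ℝ} {t : ℝ}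
    (h : HasVelocityWithinAt γ v I t) (hδ : δ =ᶠ[𝓝[I] t] γ) (ht : δ t = γ t) :
    HasVelocityWithinAt δ v I t := by
  refine ⟨h.1.congr_of_eventuallyEq hδ ht, ?_⟩
  rw [ht]
  exact h.2.congr_of_eventuallyEq (hδ.mono fun s hs => congrArg _ hs) (by rw [ht])

theorem hasVelocityWithinAt_const (x : M) (I : Set ℝ) (t : ℝ) :
    HasVelocityWithinAt (fun _ => x) (0 : E) I t :=
  ⟨continuousWithinAt_const, hasDerivWithinAt_const _ _ _⟩

section Chart

variable {e : OpenPartialHomeomorph M E}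

theorem mdifferentiable_of_mem_maximalAtlas (he : e ∈ IsManifold.maximalAtlas 𝓘(ℂ, E) ω M) :
    e.MDifferentiable 𝓘(ℂ, E) 𝓘(ℂ, E) :=
  ⟨(contMDiffOn_of_mem_maximalAtlas he).mdifferentiableOn (by simp),
    (contMDiffOn_symm_of_mem_maximalAtlas he).mdifferentiableOn (by simp)⟩

theorem tder_symm_tder (he : e ∈ IsManifold.maximalAtlas 𝓘(ℂ, E) ω M) {x : M} (hx : x ∈ e.source)
    (v : E) : tder E e.symm (e x) (tder E e x v) = v :=
  congrArg (fun L : E →L[ℂ] E => L v)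
    ((mdifferentiable_of_mem_maximalAtlas he).symm_comp_deriv hx)

theorem tder_tder_symm (he : e ∈ IsManifold.maximalAtlas 𝓘(ℂ, E) ω M) {z : E} (hz : z ∈ e.target)
    (v : E) : tder E e (e.symm z) (tder E e.symm z v) = v :=
  congrArg (fun L : E →L[ℂ] E => L v)
    ((mdifferentiable_of_mem_maximalAtlas he).comp_symm_deriv hz)

/-- The expression of a two-form in a chart, as a bilinear form. -/
noncomputable def chartBilin (η : TwoForm E M) (e : OpenPartialHomeomorph M E) (z : E) :
    E →L[ℂ] E →L[ℂ] ℂ :=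
  toBilin E (inChart η e z)

theorem chartBilin_apply (η : TwoForm E M) (z u v : E) :
    chartBilin η e z u v = bilin η (e.symm z) (tder E e.symm z u) (tder E e.symm z v) :=
  bilin_pullback e.symm η z u v

end Chart

end Tangent

end HolSymp

namespace HolSymp

/-! ### The primitive on the manifold and charts around points of `Y` -/

section MoserChart

set_option maxSynthPendingDepth 3

open Metric Filter Topology

variable {E : Type*} [NormedAddCommGroup E] [NormedSpace ℂ E]
  {X : Type*} [TopologicalSpace X] [ChartedSpace E X]

/-- The velocity at time `t ∈ [0, 1]` of the curve `s ↦ φ s x`. -/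
noncomputable def pathVelocity (E : Type*) [NormedAddCommGroup E] [NormedSpace ℂ E]
    {X : Type*} [TopologicalSpace X] [ChartedSpace E X] (φ : ℝ → X → X) (t : ℝ) (x : X) : E :=
  derivWithin (fun s => chartAt E (φ t x) (φ s x)) (Icc 0 1) t

theorem HasVelocityWithinAt.pathVelocity_eq {φ : ℝ → X → X} {t : ℝ} {x : X} {v : E}
    (h : HasVelocityWithinAt (fun s => φ s x) v (Icc 0 1) t) (ht : t ∈ Icc (0 : ℝ) 1) :
    pathVelocity E φ t x = v :=
  h.2.derivWithin (uniqueDiffOn_Icc zero_lt_one t ht)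

/-- The primitive of `η₁ - η₀` given by the homotopy `φ`. -/
noncomputable def moserPrimitive (η₀ η₁ : TwoForm E X) (φ : ℝ → X → X) (x : X) : E →L[ℂ] ℂ :=
  ∫ t in (0 : ℝ)..1, ((bilin η₁ (φ t x) - bilin η₀ (φ t x)) (pathVelocity E φ t x)).comp
    (tder E (φ t) x)

/-- A chart in whose open subset `V` of the target the Moser trick can be carried out. -/
structure IsMoserChart (η₀ η₁ : TwoForm E X) (φ : ℝ → X → X) (U : Set X)
    (e : OpenPartialHomeomorph X E) (V : Set E) (s : E → E →L[ℂ] ℂ) : Prop where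
  mem_maximalAtlas : e ∈ IsManifold.maximalAtlas 𝓘(ℂ, E) ω X
  subset_target : V ⊆ e.target
  mapsTo_symm : MapsTo e.symm V U
  isMoserData : IsMoserData V (chartBilin η₀ e) (chartBilin η₁ e) s
  primitive_eq : ∀ z ∈ V, ∀ u, s z u = moserPrimitive η₀ η₁ φ (e.symm z) (tder E e.symm z u)

section

variable {e : OpenPartialHomeomorph X E} {η : TwoForm E X}

theorem IsHolomorphicSymplectic.differentiableOn_chartBilin (h : IsHolomorphicSymplectic η)
    (he : e ∈ IsManifold.maximalAtlas 𝓘(ℂ, E) ω X) :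
    DifferentiableOn ℂ (chartBilin η e) e.target :=
  (toBilin E).differentiable.comp_differentiableOn (h.holomorphic e he)

theorem IsHolomorphicSymplectic.isClosedAt_chartBilin (h : IsHolomorphicSymplectic η)
    (he : e ∈ IsManifold.maximalAtlas 𝓘(ℂ, E) ω X) {z : E} (hz : z ∈ e.target) :
    IsClosedAt (chartBilin η e) z :=
  isClosedAt_toBilin ((h.holomorphic e he).differentiableAt (e.open_target.mem_nhds hz))
    (h.closed e he z hz)

theorem IsHolomorphicSymplectic.bilin_nondegenerate (h : IsHolomorphicSymplectic η) (x : X) (u : E)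
    (hu : ∀ w, bilin η x u w = 0) : u = 0 :=
  h.nondegenerate x u fun w => (toBilin_apply (E := E) (η x) u w).symm.trans (hu w)

theorem IsHolomorphicSymplectic.chartBilin_nondegenerate (h : IsHolomorphicSymplectic η)
    (he : e ∈ IsManifold.maximalAtlas 𝓘(ℂ, E) ω X) {z : E} (hz : z ∈ e.target) (u : E)
    (hu : ∀ w, chartBilin η e z u w = 0) : u = 0 := by
  have h1 : tder E e.symm z u = 0 := h.bilin_nondegenerate (e.symm z) _ fun w => by
    have h2 := hu (tder E e (e.symm z) w)
    rw [chartBilin_apply] at h2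
    have h3 := tder_symm_tder he (e.map_target hz) w
    rw [e.right_inv hz] at h3
    rwa [h3] at h2
  rw [← tder_tder_symm he hz u, h1, map_zero]

theorem chartBilin_skew (η : TwoForm E X) (z u w : E) :
    chartBilin η e z u w = -chartBilin η e z w u :=
  toBilin_skew _ _ _

theorem chartBilin_congr {η₀ η₁ : TwoForm E X} {z : E} (h : η₀ (e.symm z) = η₁ (e.symm z)) :
    chartBilin η₀ e z = chartBilin η₁ e z := by
  ext u w
  rw [chartBilin_apply, chartBilin_apply, bilin, bilin, h]

theorem segmentForm_chartBilin (η₀ η₁ : TwoForm E X) (t : ℝ) (z u w : E) :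
    segmentForm (chartBilin η₀ e) (chartBilin η₁ e) t z u w
      = segmentForm (bilin η₀) (bilin η₁) t (e.symm z) (tder E e.symm z u) (tder E e.symm z w) := by
  simp only [segmentForm, add_apply, smul_apply, sub_apply, chartBilin_apply]

theorem IsClosedAt.sub {B₀ B₁ : E → E →L[ℂ] E →L[ℂ] ℂ} {z : E} (h₁ : IsClosedAt B₁ z)
    (h₀ : IsClosedAt B₀ z) (d₁ : DifferentiableAt ℂ B₁ z) (d₀ : DifferentiableAt ℂ B₀ z) :
    IsClosedAt (fun z => B₁ z - B₀ z) z := by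
  intro a b c
  rw [fderiv_fun_sub d₁ d₀]
  simp only [sub_apply]
  linear_combination h₁ a b c - h₀ a b c

end

/-- The homotopy is jointly differentiable with a real time variable, so holomorphic charts must be
read as real ones before being composed with it. -/
theorem contMDiffOn_real_of_complex {M N : Type*} [TopologicalSpace M] [ChartedSpace E M]
    [TopologicalSpace N] [ChartedSpace E N] {f : M → N} {s : Set M} {n : WithTop ℕ∞}
    (hf : ContMDiffOn 𝓘(ℂ, E) 𝓘(ℂ, E) n f s) : ContMDiffOn 𝓘(ℝ, E) 𝓘(ℝ, E) n f s := fun x hx => by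
  obtain ⟨h1, h2⟩ := contMDiffWithinAt_iff.1 (hf x hx)
  exact contMDiffWithinAt_iff.2 ⟨h1, h2.restrict_scalars ℝ⟩

variable {η₀ η₁ : TwoForm E X}
  {φ : ℝ → X → X} {U Y : Set X}

/-- The homotopy read in a chart. -/
theorem exists_isHolomorphicHomotopy (hU : IsOpen U) (hφ : IsHolomorphicRetractionFamily E U Y φ)
    {e : OpenPartialHomeomorph X E} (he : e ∈ IsManifold.maximalAtlas 𝓘(ℂ, E) ω X)
    {V : Set E} (hV : IsOpen V) (hVt : V ⊆ e.target) (hVU : MapsTo e.symm V U)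
    (hVφ : ∀ z ∈ V, ∀ t ∈ Icc (0 : ℝ) 1, φ t (e.symm z) ∈ e.source) :
    ∃ g', IsHolomorphicHomotopy V e.target (fun t z => e (φ t (e.symm z))) g' := by
  have hed := mdifferentiable_of_mem_maximalAtlas he
  have hG : ContDiffOn ℝ 1 (fun q : ℝ × E => e (φ q.1 (e.symm q.2))) (Icc (0 : ℝ) 1 ×ˢ V) := by
    have he1 := (contMDiffOn_real_of_complex (contMDiffOn_of_mem_maximalAtlas he)).of_le
      (show 1 ≤ ω by simp)
    have he2 := (contMDiffOn_real_of_complex (contMDiffOn_symm_of_mem_maximalAtlas he)).of_le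
      (show 1 ≤ ω by simp)
    have h1 : ContMDiffOn (𝓘(ℝ, ℝ).prod 𝓘(ℝ, E)) (𝓘(ℝ, ℝ).prod 𝓘(ℝ, E)) 1
        (fun q : ℝ × E => (q.1, e.symm q.2)) (Icc (0 : ℝ) 1 ×ˢ V) :=
      contMDiff_fst.contMDiffOn.prodMk
        (he2.comp contMDiff_snd.contMDiffOn fun q hq => hVt hq.2)
    have h2 := he1.comp (hφ.differentiable.comp h1 fun q hq => ⟨hq.1, hVU hq.2⟩)
      fun q hq => hVφ q.2 hq.2 q.1 hq.1
    rw [← contMDiffOn_iff_contDiffOn, modelWithCornersSelf_prod, ← chartedSpaceSelf_prod]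
    exact h2
  have hu : UniqueDiffOn ℝ (Icc (0 : ℝ) 1 ×ˢ V) :=
    (uniqueDiffOn_Icc zero_lt_one).prod hV.uniqueDiffOn
  refine ⟨fun t z => fderivWithin ℝ (fun q : ℝ × E => e (φ q.1 (e.symm q.2)))
    (Icc (0 : ℝ) 1 ×ˢ V) (t, z) (1, 0), ⟨fun t ht z hz => e.map_source (hVφ z hz t ht), ?_,
    hG.continuousOn, ?_, ?_⟩⟩
  · intro t ht z hz
    have h1 : MDifferentiableAt 𝓘(ℂ, E) 𝓘(ℂ, E) e.symm z :=
      (hed.2).mdifferentiableAt (e.open_target.mem_nhds (hVt hz))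
    have h2 : MDifferentiableAt 𝓘(ℂ, E) 𝓘(ℂ, E) (φ t) (e.symm z) :=
      (hφ.holomorphic t ht).mdifferentiableAt (hU.mem_nhds (hVU hz))
    have h3 : MDifferentiableAt 𝓘(ℂ, E) 𝓘(ℂ, E) e (φ t (e.symm z)) :=
      (hed.1).mdifferentiableAt (e.open_source.mem_nhds (hVφ z hz t ht))
    exact (h3.comp z (h2.comp z h1)).differentiableAt.differentiableWithinAt
  · intro t ht z hz
    have h1 := ((hG.differentiableOn one_ne_zero) (t, z) ⟨ht, hz⟩).hasFDerivWithinAt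
    have h2 : HasDerivWithinAt (fun s : ℝ => (s, z)) ((1 : ℝ), (0 : E)) (Icc 0 1) t :=
      ((hasDerivAt_id t).prodMk (hasDerivAt_const t z)).hasDerivWithinAt
    have h3 : MapsTo (fun s : ℝ => (s, z)) (Icc 0 1) (Icc (0 : ℝ) 1 ×ˢ V) :=
      fun s hs => ⟨hs, hz⟩
    exact h1.comp_hasDerivWithinAt t h2 h3
  · exact (hG.continuousOn_fderivWithin hu le_rfl).clm_apply continuousOn_const

variable [FiniteDimensional ℂ E]

/-- The primitive `moserPrimitive` read in a chart. -/
theorem homotopyForm_eq_moserPrimitive (hU : IsOpen U)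
    (hφ : IsHolomorphicRetractionFamily E U Y φ)
    (h₀ : IsHolomorphicSymplectic η₀) (h₁ : IsHolomorphicSymplectic η₁)
    {e : OpenPartialHomeomorph X E} (he : e ∈ IsManifold.maximalAtlas 𝓘(ℂ, E) ω X)
    {V : Set E} (hV : IsOpen V) (hVt : V ⊆ e.target) (hVU : MapsTo e.symm V U)
    (hVφ : ∀ z ∈ V, ∀ t ∈ Icc (0 : ℝ) 1, φ t (e.symm z) ∈ e.source) {g' : ℝ → E → E}
    (hg : IsHolomorphicHomotopy V e.target (fun t z => e (φ t (e.symm z))) g')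
    {z : E} (hz : z ∈ V) (u : E) :
    homotopyForm (fun z => chartBilin η₁ e z - chartBilin η₀ e z)
      (fun t z => e (φ t (e.symm z))) g' z u
      = moserPrimitive η₀ η₁ φ (e.symm z) (tder E e.symm z u) := by
  have hed := mdifferentiable_of_mem_maximalAtlas he
  set g : ℝ → E → E := fun t z => e (φ t (e.symm z)) with hgdef
  have hinv : ∀ t ∈ Icc (0 : ℝ) 1, ∀ z ∈ V, e.symm (g t z) = φ t (e.symm z) := fun t ht z hz =>
    e.left_inv (hVφ z hz t ht)
  have hsymm : ∀ t ∈ Icc (0 : ℝ) 1, ∀ z ∈ V,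
      MDifferentiableAt 𝓘(ℂ, E) 𝓘(ℂ, E) e.symm (g t z) := fun t ht z hz =>
    (hed.2).mdifferentiableAt (e.open_target.mem_nhds (hg.mapsTo t ht hz))
  have hsz : MDifferentiableAt 𝓘(ℂ, E) 𝓘(ℂ, E) e.symm z :=
    (hed.2).mdifferentiableAt (e.open_target.mem_nhds (hVt hz))
  have hvel : ∀ t ∈ Icc (0 : ℝ) 1,
      pathVelocity E φ t (e.symm z) = tder E e.symm (g t z) (g' t z) := fun t ht => by
    have h1 := HasVelocityWithinAt.comp (γ := fun s => g s z) (hsymm t ht z hz)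
      (hasVelocityWithinAt_iff_hasDerivWithinAt.2 (hg.hasDerivWithinAt t ht z hz))
    refine (h1.congr_of_eventuallyEq ?_ (hinv t ht z hz).symm).pathVelocity_eq ht
    filter_upwards [self_mem_nhdsWithin] with s hs using (hinv s hs z hz).symm
  have hder : ∀ t ∈ Icc (0 : ℝ) 1, (tder E (φ t) (e.symm z)).comp (tder E e.symm z)
      = (tder E e.symm (g t z)).comp (fderiv ℂ (g t) z) := fun t ht => by
    have h2 : MDifferentiableAt 𝓘(ℂ, E) 𝓘(ℂ, E) (φ t) (e.symm z) :=
      (hφ.holomorphic t ht).mdifferentiableAt (hU.mem_nhds (hVU hz))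
    have h3 : MDifferentiableAt 𝓘(ℂ, E) 𝓘(ℂ, E) (g t) z :=
      ((hg.differentiableOn t ht).differentiableAt (hV.mem_nhds hz)).mdifferentiableAt
    rw [← tder_eq_fderiv, ← tder_comp h2 hsz, ← tder_comp (hsymm t ht z hz) h3]
    refine tder_congr ?_
    filter_upwards [hV.mem_nhds hz] with y hy using (hinv t ht y hy).symm
  set B : E → E →L[ℂ] E →L[ℂ] ℂ := fun z => chartBilin η₁ e z - chartBilin η₀ e z with hB
  have hBd : DifferentiableOn ℂ B e.target :=
    (h₁.differentiableOn_chartBilin he).sub (h₀.differentiableOn_chartBilin he)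
  set L : ℝ → E →L[ℂ] ℂ := fun t => ((bilin η₁ (φ t (e.symm z)) - bilin η₀ (φ t (e.symm z)))
    (pathVelocity E φ t (e.symm z))).comp (tder E (φ t) (e.symm z)) with hL
  set A : ℝ → E →L[ℂ] ℂ := fun t => (B (g t z) (g' t z)).comp (fderiv ℂ (g t) z) with hA
  -- Writing `L t` as `A t` followed by a map independent of `t` lets that map be pulled out of the
  -- integral, with integrability inherited from the continuity of `A` in the chart.
  have hLA : ∀ t ∈ Icc (0 : ℝ) 1, L t = (A t).comp (tder E e (e.symm z)) := fun t ht => by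
    have key : (L t).comp (tder E e.symm z) = A t := by
      ext w
      have h1 := congrArg (fun l : E →L[ℂ] E => l w) (hder t ht)
      simp only [ContinuousLinearMap.comp_apply] at h1
      simp only [hL, hA, hB, ContinuousLinearMap.comp_apply, sub_apply, chartBilin_apply]
      rw [h1, hvel t ht, hinv t ht z hz]
    ext w
    rw [← key]
    simp only [ContinuousLinearMap.comp_apply]
    have := tder_symm_tder he (e.map_target (hVt hz)) w
    rw [e.right_inv (hVt hz)] at this
    rw [this]
  have hAc : ContinuousOn A (Icc 0 1) :=
    (hg.continuousOn_integrand hV hBd).comp (f := fun t => (t, z)) (by fun_prop)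
      fun t ht => ⟨ht, hz⟩
  have hAi : IntervalIntegrable A MeasureTheory.volume 0 1 := by
    rw [← uIcc_of_le (zero_le_one' ℝ)] at hAc
    exact hAc.intervalIntegrable
  have h1 : moserPrimitive η₀ η₁ φ (e.symm z)
      = (homotopyForm B g g' z).comp (tder E e (e.symm z)) := by
    have h2 : ∫ t in (0 : ℝ)..1, L t
        = ∫ t in (0 : ℝ)..1, (A t).comp (tder E e (e.symm z)) :=
      intervalIntegral.integral_congr fun t ht => hLA t (by
        rwa [uIcc_of_le (zero_le_one' ℝ)] at ht)
    have h3 := (ContinuousLinearMap.precomp ℂ (tder E e (e.symm z))).intervalIntegral_comp_comm hAi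
    exact h2.trans h3
  rw [h1, ContinuousLinearMap.comp_apply, tder_tder_symm he (hVt hz)]

/-- Around every point of `Y` there is a chart in which the Moser trick can be carried out. -/
theorem exists_isMoserChart [IsManifold 𝓘(ℂ, E) ω X] (hU : IsOpen U) (hYU : Y ⊆ U)
    (hφ : IsHolomorphicRetractionFamily E U Y φ)
    (h₀ : IsHolomorphicSymplectic η₀) (h₁ : IsHolomorphicSymplectic η₁)
    (hY : ∀ y ∈ Y, η₀ y = η₁ y) {y : X} (hy : y ∈ Y) :
    ∃ V s, IsMoserChart η₀ η₁ φ U (chartAt E y) V s ∧ chartAt E y y ∈ V ∧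
      s (chartAt E y y) = 0 := by
  set e := chartAt E y with hedef
  have hye : y ∈ e.source := mem_chart_source E y
  have he : e ∈ IsManifold.maximalAtlas 𝓘(ℂ, E) ω X := IsManifold.chart_mem_maximalAtlas y
  set p := e y with hp
  have hpt : p ∈ e.target := e.map_source hye
  have hpy : e.symm p = y := e.left_inv hye
  have hcs : ContinuousAt e.symm p := e.continuousAt_symm hpt
  have hevU : ∀ᶠ z in 𝓝 p, e.symm z ∈ U := hcs.eventually (hU.mem_nhds (hpy ▸ hYU hy))
  -- Tube lemma: all `φ t` fix `y` and `[0, 1]` is compact, so nearby points keep their whole paths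
  -- inside the chart.
  have hevφ : ∀ᶠ z in 𝓝 p, ∀ t ∈ Icc (0 : ℝ) 1, e.symm z ∈ U → φ t (e.symm z) ∈ e.source := by
    have : ∀ᶠ z in 𝓝 p, ∀ t ∈ Icc (0 : ℝ) 1, (t, e.symm z) ∈ Icc (0 : ℝ) 1 ×ˢ U →
        φ t (e.symm z) ∈ e.source := by
      refine isCompact_Icc.eventually_forall_of_forall_eventually fun t ht => ?_
      have h1 : ContinuousWithinAt (fun q : ℝ × X => φ q.1 q.2) (Icc (0 : ℝ) 1 ×ˢ U) (t, y) :=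
        hφ.differentiable.continuousOn (t, y) ⟨ht, hYU hy⟩
      have h2 := eventually_nhdsWithin_iff.1 (h1.eventually (e.open_source.mem_nhds
        (show φ t y ∈ e.source from (hφ.fix t ht hy).symm ▸ hye)))
      have h3 : ContinuousAt (fun q : E × ℝ => (q.2, e.symm q.1)) (p, t) :=
        continuousAt_snd.prodMk (ContinuousAt.comp (g := e.symm) (f := Prod.fst) hcs
          continuousAt_fst)
      have h4 : Tendsto (fun q : E × ℝ => (q.2, e.symm q.1)) (𝓝 (p, t)) (𝓝 (t, y)) :=
        hpy ▸ h3.tendsto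
      exact h4.eventually h2
    exact this.mono fun z hz t ht hzU => hz t ht ⟨ht, hzU⟩
  have hd₀ := h₀.differentiableOn_chartBilin he
  have hd₁ := h₁.differentiableOn_chartBilin he
  have hBp : chartBilin η₁ e p = chartBilin η₀ e p :=
    chartBilin_congr (by rw [hpy]; exact (hY y hy).symm)
  -- At `p` the two forms agree, so the segment between them is constant, equal to the first form;
  -- nondegeneracy then persists nearby for all `t ∈ [-1, 2]`.
  have hevn := eventually_segmentForm_nondegenerate
    (hd₀.differentiableAt (e.open_target.mem_nhds hpt)).continuousAt
    (hd₁.differentiableAt (e.open_target.mem_nhds hpt)).continuousAt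
    (isCompact_Icc (a := (-1 : ℝ)) (b := 2)) fun t _ u hu =>
      h₀.chartBilin_nondegenerate he hpt u fun w => by
        have := hu w
        rwa [segmentForm, hBp, sub_self, smul_zero, add_zero] at this
  obtain ⟨V, hVsub, hV, hpV⟩ := _root_.mem_nhds_iff.1 (((hevU.and hevφ).and hevn).and
    (e.open_target.mem_nhds hpt))
  have hVt : V ⊆ e.target := fun z hz => (hVsub hz).2
  have hVU : MapsTo e.symm V U := fun z hz => (hVsub hz).1.1.1
  have hVφ : ∀ z ∈ V, ∀ t ∈ Icc (0 : ℝ) 1, φ t (e.symm z) ∈ e.source := fun z hz t ht =>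
    (hVsub hz).1.1.2 t ht (hVU hz)
  obtain ⟨g', hg⟩ := exists_isHolomorphicHomotopy hU hφ he hV hVt hVU hVφ
  have hz0 : (0 : ℝ) ∈ Icc (0 : ℝ) 1 := by simp
  have hz1 : (1 : ℝ) ∈ Icc (0 : ℝ) 1 := by simp
  have hspec := hg.homotopyForm_spec hV e.open_target (hd₁.sub hd₀)
    (B := fun z => chartBilin η₁ e z - chartBilin η₀ e z)
    (fun z _ u v => by
      simp only [sub_apply]
      rw [chartBilin_skew η₁ z u v, chartBilin_skew η₀ z u v]
      ring)
    (fun z hz => (h₁.isClosedAt_chartBilin he hz).sub (h₀.isClosedAt_chartBilin he hz)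
      (hd₁.differentiableAt (e.open_target.mem_nhds hz))
      (hd₀.differentiableAt (e.open_target.mem_nhds hz)))
    (fun z hz => by
      have h1 : φ 0 (e.symm z) ∈ Y := hφ.image_zero ▸ mem_image_of_mem _ (hVU hz)
      refine sub_eq_zero.2 (chartBilin_congr ?_)
      rw [e.left_inv (hVφ z hz 0 hz0)]
      exact (hY _ h1).symm)
    (fun z hz => by
      rw [hφ.map_one (hVU hz)]
      exact e.right_inv (hVt hz))
  refine ⟨V, _, ⟨he, hVt, hVU, ⟨hV, hd₀.mono hVt, hd₁.mono hVt, fun z _ => chartBilin_skew η₀ z,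
    fun z _ => chartBilin_skew η₁ z, fun z hz => h₀.isClosedAt_chartBilin he (hVt hz),
    fun z hz => h₁.isClosedAt_chartBilin he (hVt hz), hspec.1, hspec.2,
    fun t ht z hz => (hVsub hz).1.2 t ht⟩,
    fun z hz u => homotopyForm_eq_moserPrimitive hU hφ h₀ h₁ he hV hVt hVU hVφ hg hz u⟩, hpV, ?_⟩
  -- The path of a point of `Y` is constant, so its velocity, and with it the integrand of the
  -- primitive, vanishes at `p`.
  have hg0 : ∀ t ∈ Icc (0 : ℝ) 1, g' t p = 0 := fun t ht => by
    refine (uniqueDiffOn_Icc zero_lt_one t ht).eq_deriv _ (hg.hasDerivWithinAt t ht p hpV) ?_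
    refine (hasDerivWithinAt_const t _ p).congr (fun s hs => ?_) ?_
    · rw [hpy, hφ.fix s hs hy]; rfl
    · rw [hpy, hφ.fix t ht hy]; rfl
  rw [homotopyForm, intervalIntegral.integral_congr (g := fun _ => 0) fun t ht => ?_,
    intervalIntegral.integral_zero]
  rw [uIcc_of_le (zero_le_one' ℝ)] at ht
  simp only [hg0 t ht, map_zero, ContinuousLinearMap.zero_comp]

end MoserChart

end HolSymp

namespace HolSymp

/-! ### Integral curves on the manifold: symmetry and uniqueness -/

section MoserCurve

set_option maxSynthPendingDepth 3

open Metric Filter Topology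

variable {E : Type*} [NormedAddCommGroup E] [NormedSpace ℂ E]
  {X : Type*} [TopologicalSpace X] [ChartedSpace E X]
  {K : Type*} [Group K] [MulAction K X]
  {η₀ η₁ : TwoForm E X} {φ : ℝ → X → X} {U Y : Set X}

/-- Moser's equation in a chart follows from Moser's equation on the manifold. -/
theorem IsMoserChart.moserEquation_chart {e : OpenPartialHomeomorph X E} {V : Set E}
    {s : E → E →L[ℂ] ℂ} (h : IsMoserChart η₀ η₁ φ U e V s) {t : ℝ} {x : X} (hx : x ∈ e.source)
    (hxV : e x ∈ V) {v : E}
    (hv : MoserEquation (bilin η₀) (bilin η₁) (moserPrimitive η₀ η₁ φ) t x v) :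
    MoserEquation (chartBilin η₀ e) (chartBilin η₁ e) s t (e x) (tder E e x v) := by
  intro w
  rw [segmentForm_chartBilin, h.primitive_eq _ hxV, tder_symm_tder h.mem_maximalAtlas hx,
    e.left_inv hx]
  exact hv _

/-- Moser's equation on the manifold follows from Moser's equation in a chart. -/
theorem IsMoserChart.moserEquation_symm {e : OpenPartialHomeomorph X E} {V : Set E}
    {s : E → E →L[ℂ] ℂ} (h : IsMoserChart η₀ η₁ φ U e V s) {t : ℝ} {z : E} (hz : z ∈ V) {u : E}
    (hu : MoserEquation (chartBilin η₀ e) (chartBilin η₁ e) s t z u) :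
    MoserEquation (bilin η₀) (bilin η₁) (moserPrimitive η₀ η₁ φ) t (e.symm z)
      (tder E e.symm z u) := by
  intro w
  have h1 := tder_symm_tder h.mem_maximalAtlas (e.map_target (h.subset_target hz)) w
  rw [e.right_inv (h.subset_target hz)] at h1
  have h2 := hu (tder E e (e.symm z) w)
  rwa [segmentForm_chartBilin, h.primitive_eq _ hz, h1] at h2

variable (K) in
/-- The points which are moved by `K` into the domain of a chart in which the Moser trick can be
carried out. -/
def moserRegion (η₀ η₁ : TwoForm E X) (φ : ℝ → X → X) (U : Set X) : Set X :=
  {x | ∃ k : K, ∃ e V s, IsMoserChart η₀ η₁ φ U e V s ∧ k • x ∈ e.source ∧ e (k • x) ∈ V}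

variable (K) in
/-- Integral curves of the time-dependent Moser vector field inside the `moserRegion`. -/
def IsMoserCurve (η₀ η₁ : TwoForm E X) (φ : ℝ → X → X) (U : Set X) (γ : ℝ → X) : Prop :=
  ∀ t ∈ Ioo (-1 : ℝ) 2, γ t ∈ moserRegion K η₀ η₁ φ U ∧
    ∃ v, HasVelocityWithinAt γ v univ t ∧
      MoserEquation (bilin η₀) (bilin η₁) (moserPrimitive η₀ η₁ φ) t (γ t) v

theorem IsMoserCurve.continuousAt {γ : ℝ → X} (h : IsMoserCurve K η₀ η₁ φ U γ) {t : ℝ}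
    (ht : t ∈ Ioo (-1 : ℝ) 2) : ContinuousAt γ t := by
  obtain ⟨-, v, hv, -⟩ := h t ht
  exact continuousWithinAt_univ _ _ |>.1 hv.1

variable (K) in
/-- A group acting by holomorphic symmetries of all the data of the Moser trick. -/
structure IsMoserAction (η₀ η₁ : TwoForm E X) (φ : ℝ → X → X) (U : Set X) : Prop where
  holomorphic : ∀ k : K, MDifferentiable 𝓘(ℂ, E) 𝓘(ℂ, E) (fun x : X => k • x)
  pullback_zero : ∀ k : K, pullback (fun x : X => k • x) η₀ = η₀
  pullback_one : ∀ k : K, pullback (fun x : X => k • x) η₁ = η₁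
  smul_mem : ∀ k : K, ∀ x ∈ U, k • x ∈ U
  equivariant : ∀ k : K, ∀ t ∈ Icc (0 : ℝ) 1, ∀ x ∈ U, φ t (k • x) = k • φ t x

namespace IsMoserAction

theorem bilin_smul_zero (hK : IsMoserAction K η₀ η₁ φ U) (k : K) (x : X) (u v : E) :
    bilin η₀ (k • x) (tder E (fun x : X => k • x) x u) (tder E (fun x : X => k • x) x v)
      = bilin η₀ x u v := by
  conv_rhs => rw [← hK.pullback_zero k]
  exact (bilin_pullback _ _ _ _ _).symm

theorem bilin_smul_one (hK : IsMoserAction K η₀ η₁ φ U) (k : K) (x : X) (u v : E) :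
    bilin η₁ (k • x) (tder E (fun x : X => k • x) x u) (tder E (fun x : X => k • x) x v)
      = bilin η₁ x u v := by
  conv_rhs => rw [← hK.pullback_one k]
  exact (bilin_pullback _ _ _ _ _).symm

theorem tder_inv_comp (hK : IsMoserAction K η₀ η₁ φ U) (k : K) (x : X) :
    (tder E (fun x : X => k⁻¹ • x) (k • x)).comp (tder E (fun x : X => k • x) x) = .id ℂ E := by
  rw [← tder_comp (hK.holomorphic k⁻¹ (k • x)) (hK.holomorphic k x), ← tder_id x]
  congr 1
  ext y
  simp

/-- The derivative of the action of a group element as an equivalence. -/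
theorem exists_tder_equiv (hK : IsMoserAction K η₀ η₁ φ U) (k : K) (x : X) :
    ∃ A : E ≃L[ℂ] E, (A : E →L[ℂ] E) = tder E (fun x : X => k • x) x := by
  have h1 := hK.tder_inv_comp k x
  have h2 := hK.tder_inv_comp k⁻¹ (k • x)
  rw [inv_inv, inv_smul_smul] at h2
  exact ⟨ContinuousLinearEquiv.equivOfInverse _ _ (fun v => congrArg (fun L : E →L[ℂ] E => L v) h1)
    fun v => congrArg (fun L : E →L[ℂ] E => L v) h2, rfl⟩

theorem pathVelocity_smul (hK : IsMoserAction K η₀ η₁ φ U)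
    (hφ : IsHolomorphicRetractionFamily E U Y φ) (k : K) {x : X} (hx : x ∈ U) {t : ℝ}
    (ht : t ∈ Icc (0 : ℝ) 1) :
    pathVelocity E φ t (k • x) = tder E (fun x : X => k • x) (φ t x) (pathVelocity E φ t x) := by
  -- Joint differentiability of `φ` guarantees that `pathVelocity` is a genuine velocity and not the
  -- default value of `derivWithin`; the chain rule then applies to the translated path.
  have h1 : ContMDiffWithinAt 𝓘(ℝ, ℝ) 𝓘(ℝ, E) 1 (fun s => φ s x) (Icc 0 1) t :=
    ContMDiffWithinAt.comp t (hφ.differentiable (t, x) ⟨ht, hx⟩)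
      (contMDiffWithinAt_id.prodMk contMDiffWithinAt_const)
      (show MapsTo (fun s : ℝ => (s, x)) (Icc 0 1) (Icc (0 : ℝ) 1 ×ˢ U) from fun s hs => ⟨hs, hx⟩)
  obtain ⟨h2, h3⟩ := contMDiffWithinAt_iff.1 h1
  have h4 : DifferentiableWithinAt ℝ (fun s => chartAt E (φ t x) (φ s x)) (Icc 0 1) t := by
    have h3' : ContDiffWithinAt ℝ 1 (fun s => chartAt E (φ t x) (φ s x))
      (Icc 0 1 ∩ range 𝓘(ℝ, ℝ)) t := h3
    rw [modelWithCornersSelf_coe, range_id, inter_univ] at h3'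
    exact h3'.differentiableWithinAt one_ne_zero
  have h5 : HasVelocityWithinAt (fun s => φ s x) (pathVelocity E φ t x) (Icc 0 1) t :=
    ⟨h2, h4.hasDerivWithinAt⟩
  have h6 := HasVelocityWithinAt.comp (f := fun x : X => k • x) (hK.holomorphic k _) h5
  refine (h6.congr_of_eventuallyEq ?_ (hK.equivariant k t ht x hx)).pathVelocity_eq ht
  filter_upwards [self_mem_nhdsWithin] with s hs using hK.equivariant k s hs x hx

theorem tder_comp_smul (hK : IsMoserAction K η₀ η₁ φ U) (hU : IsOpen U)
    (hφ : IsHolomorphicRetractionFamily E U Y φ) (k : K) {x : X} (hx : x ∈ U) {t : ℝ}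
    (ht : t ∈ Icc (0 : ℝ) 1) :
    (tder E (φ t) (k • x)).comp (tder E (fun x : X => k • x) x)
      = (tder E (fun x : X => k • x) (φ t x)).comp (tder E (φ t) x) := by
  have hd : ∀ y ∈ U, MDifferentiableAt 𝓘(ℂ, E) 𝓘(ℂ, E) (φ t) y := fun y hy =>
    (hφ.holomorphic t ht).mdifferentiableAt (hU.mem_nhds hy)
  rw [← tder_comp (hd _ (hK.smul_mem k x hx)) (hK.holomorphic k x),
    ← tder_comp (hK.holomorphic k _) (hd x hx)]
  refine tder_congr ?_
  filter_upwards [hU.mem_nhds hx] with y hy using hK.equivariant k t ht y hy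

/-- The integrands at `x` and `k • x` correspond under the derivative of `k`, by equivariance of `φ`
and invariance of both forms. As this derivative is an isomorphism, it commutes with the integral
without any integrability condition. -/
theorem moserPrimitive_smul (hK : IsMoserAction K η₀ η₁ φ U) (hU : IsOpen U)
    (hφ : IsHolomorphicRetractionFamily E U Y φ) (k : K) {x : X} (hx : x ∈ U) (v : E) :
    moserPrimitive η₀ η₁ φ (k • x) (tder E (fun x : X => k • x) x v)
      = moserPrimitive η₀ η₁ φ x v := by
  obtain ⟨A, hA⟩ := hK.exists_tder_equiv k x
  set L : X → ℝ → E →L[ℂ] ℂ := fun x t => ((bilin η₁ (φ t x) - bilin η₀ (φ t x))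
    (pathVelocity E φ t x)).comp (tder E (φ t) x) with hL
  have hLk : ∀ t ∈ Icc (0 : ℝ) 1, (L (k • x) t).comp (A : E →L[ℂ] E) = L x t := fun t ht => by
    ext w
    have h1 := congrArg (fun l : E →L[ℂ] E => l w) (hK.tder_comp_smul hU hφ k hx ht)
    simp only [ContinuousLinearMap.comp_apply] at h1
    simp only [hL, hA, ContinuousLinearMap.comp_apply, sub_apply]
    rw [h1, hK.pathVelocity_smul hφ k hx ht, hK.equivariant k t ht x hx, hK.bilin_smul_zero,
      hK.bilin_smul_one]
  have h2 : ∫ t in (0 : ℝ)..1, L x t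
      = ∫ t in (0 : ℝ)..1, (A.symm.arrowCongr (.refl ℂ ℂ)) (L (k • x) t) :=
    intervalIntegral.integral_congr fun t ht => by
      rw [uIcc_of_le (zero_le_one' ℝ)] at ht
      exact (hLk t ht).symm
  have h3 : ∫ t in (0 : ℝ)..1, (A.symm.arrowCongr (.refl ℂ ℂ)) (L (k • x) t)
      = (A.symm.arrowCongr (.refl ℂ ℂ)) (∫ t in (0 : ℝ)..1, L (k • x) t) := by
    rw [intervalIntegral.integral_of_le zero_le_one, intervalIntegral.integral_of_le zero_le_one]
    exact ContinuousLinearEquiv.integral_comp_comm _ _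
  have h4 := congrArg (fun l : E →L[ℂ] ℂ => l v) (h2.trans h3)
  rw [← hA]
  exact h4.symm

/-- The derivative of `k` is onto, so it suffices to test against vectors in its image, where both
sides are invariant. -/
theorem moserEquation_smul (hK : IsMoserAction K η₀ η₁ φ U) (hU : IsOpen U)
    (hφ : IsHolomorphicRetractionFamily E U Y φ) (k : K) {x : X} (hx : x ∈ U) {t : ℝ} {v : E}
    (hv : MoserEquation (bilin η₀) (bilin η₁) (moserPrimitive η₀ η₁ φ) t x v) :
    MoserEquation (bilin η₀) (bilin η₁) (moserPrimitive η₀ η₁ φ) t (k • x)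
      (tder E (fun x : X => k • x) x v) := by
  intro w
  obtain ⟨A, hA⟩ := hK.exists_tder_equiv k x
  obtain ⟨w, rfl⟩ := A.surjective w
  have h1 : A w = tder E (fun x : X => k • x) x w := by rw [← hA]; rfl
  rw [h1, hK.moserPrimitive_smul hU hφ k hx, ← hv w]
  simp only [segmentForm, add_apply, smul_apply, sub_apply, hK.bilin_smul_zero, hK.bilin_smul_one]

theorem moserRegion_subset (hK : IsMoserAction K η₀ η₁ φ U) : moserRegion K η₀ η₁ φ U ⊆ U := by
  rintro x ⟨k, e, V, s, h, hx, hV⟩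
  have h1 := h.mapsTo_symm hV
  rw [e.left_inv hx] at h1
  simpa using hK.smul_mem k⁻¹ _ h1

theorem isMoserCurve_smul (hK : IsMoserAction K η₀ η₁ φ U) (hU : IsOpen U)
    (hφ : IsHolomorphicRetractionFamily E U Y φ) (k : K) {γ : ℝ → X}
    (hγ : IsMoserCurve K η₀ η₁ φ U γ) : IsMoserCurve K η₀ η₁ φ U (fun t => k • γ t) := by
  intro t ht
  obtain ⟨hreg, v, hv, hm⟩ := hγ t ht
  have hUt := hK.moserRegion_subset hreg
  obtain ⟨l, e, V, s, h, hx, hV⟩ := hreg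
  -- If `l` moves the point into a Moser chart, then `l * k⁻¹` moves its translate by `k` to the
  -- same place.
  refine ⟨⟨l * k⁻¹, e, V, s, h, ?_, ?_⟩, _,
    HasVelocityWithinAt.comp (f := fun x : X => k • x) (hK.holomorphic k _) hv,
    hK.moserEquation_smul hU hφ k hUt hm⟩
  · simpa [mul_smul] using hx
  · simpa [mul_smul] using hV

variable [FiniteDimensional ℂ E]

/-- Local uniqueness of integral curves. -/
theorem eventuallyEq_of_isMoserCurve (hK : IsMoserAction K η₀ η₁ φ U) (hU : IsOpen U)
    (hφ : IsHolomorphicRetractionFamily E U Y φ) {γ δ : ℝ → X}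
    (hγ : IsMoserCurve K η₀ η₁ φ U γ) (hδ : IsMoserCurve K η₀ η₁ φ U δ) {t₀ : ℝ}
    (ht₀ : t₀ ∈ Ioo (-1 : ℝ) 2) (h0 : γ t₀ = δ t₀) : γ =ᶠ[𝓝 t₀] δ := by
  -- Both curves are translated by `k` into a Moser chart, compared there by uniqueness for the
  -- vector field, and translated back.
  obtain ⟨k, e, V, s, h, hx, hV⟩ := (hγ t₀ ht₀).1
  have hed := mdifferentiable_of_mem_maximalAtlas h.mem_maximalAtlas
  have main : ∀ {ζ : ℝ → X}, IsMoserCurve K η₀ η₁ φ U ζ → ζ t₀ = γ t₀ →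
      ∀ᶠ t in 𝓝 t₀, k • ζ t ∈ e.source ∧ e (k • ζ t) ∈ V ∧ ∃ u,
        HasDerivAt (fun t => e (k • ζ t)) u t ∧
        MoserEquation (chartBilin η₀ e) (chartBilin η₁ e) s t (e (k • ζ t)) u := by
    intro ζ hζ hζ0
    have hζk := hK.isMoserCurve_smul hU hφ k hζ
    have hc : ContinuousAt (fun t => k • ζ t) t₀ := hζk.continuousAt ht₀
    have hs : ∀ᶠ t in 𝓝 t₀, k • ζ t ∈ e.source :=
      hc.eventually (e.open_source.mem_nhds (show k • ζ t₀ ∈ e.source by rwa [hζ0]))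
    have hVe : ∀ᶠ t in 𝓝 t₀, e (k • ζ t) ∈ V :=
      (ContinuousAt.comp (f := fun t => k • ζ t) (e.continuousAt (show k • ζ t₀ ∈ e.source by rwa [hζ0])) hc).eventually
        (h.isMoserData.isOpen.mem_nhds (by simpa [hζ0] using hV))
    filter_upwards [hs, hVe, Ioo_mem_nhds ht₀.1 ht₀.2] with t hts htV htI
    obtain ⟨-, v, hv, hm⟩ := hζk t htI
    refine ⟨hts, htV, tder E e (k • ζ t) v, ?_, h.moserEquation_chart hts htV hm⟩
    have := HasVelocityWithinAt.comp (f := e)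
      (hed.1.mdifferentiableAt (e.open_source.mem_nhds hts)) hv
    exact (hasVelocityWithinAt_iff_hasDerivWithinAt.1 this).hasDerivAt univ_mem
  have hγ' := main hγ rfl
  have hδ' := main hδ h0.symm
  have key := h.isMoserData.eventuallyEq_of_moserEquation ht₀ (hγ'.mono fun t ht => ht.2)
    (hδ'.mono fun t ht => ht.2) (by rw [h0])
  filter_upwards [hγ', hδ', key] with t h1 h2 h3
  exact smul_left_cancel k (e.injOn h1.1 h2.1 h3)

/-- Uniqueness of integral curves. -/
theorem eqOn_of_isMoserCurve [T2Space X] (hK : IsMoserAction K η₀ η₁ φ U) (hU : IsOpen U)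
    (hφ : IsHolomorphicRetractionFamily E U Y φ) {γ δ : ℝ → X}
    (hγ : IsMoserCurve K η₀ η₁ φ U γ) (hδ : IsMoserCurve K η₀ η₁ φ U δ) {t₀ : ℝ}
    (ht₀ : t₀ ∈ Ioo (-1 : ℝ) 2) (h0 : γ t₀ = δ t₀) : EqOn γ δ (Ioo (-1 : ℝ) 2) := by
  -- Connectedness: the times at which the germs agree form an open set. At a limit of such times
  -- the values agree by the Hausdorff property, hence the germs agree by local uniqueness.
  have hsub : Ioo (-1 : ℝ) 2 ⊆ {t | γ =ᶠ[𝓝 t] δ} := by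
    refine isPreconnected_Ioo.subset_of_closure_inter_subset isOpen_setOfPred_eventually_nhds
      ⟨t₀, ht₀, hK.eventuallyEq_of_isMoserCurve hU hφ hγ hδ ht₀ h0⟩ ?_
    rintro t ⟨htc, ht⟩
    refine hK.eventuallyEq_of_isMoserCurve hU hφ hγ hδ ht ?_
    refine tendsto_nhds_unique_of_frequently_eq (hγ.continuousAt ht) (hδ.continuousAt ht) ?_
    exact (mem_closure_iff_frequently.1 htc).mono fun r hr => Filter.EventuallyEq.eq_of_nhds hr
  exact fun t ht => Filter.EventuallyEq.eq_of_nhds (hsub ht)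

end IsMoserAction

end MoserCurve

end HolSymp

namespace HolSymp

/-! ### The holomorphic inverse function theorem on manifolds -/

section InverseFunction

open Filter Topology

variable {E : Type*} [NormedAddCommGroup E] [NormedSpace ℂ E] [FiniteDimensional ℂ E]
  {X : Type*} [TopologicalSpace X] [ChartedSpace E X] [IsManifold 𝓘(ℂ, E) ω X]

/-- A holomorphic map with injective derivative, read in charts, has an invertible strict
derivative. -/
theorem exists_hasStrictFDerivAt_chart {f : X → X} {W : Set X} (hW : IsOpen W)
    (hf : MDifferentiableOn 𝓘(ℂ, E) 𝓘(ℂ, E) f W) {x : X} (hx : x ∈ W)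
    (hd : Function.Injective (tder E f x)) :
    ∃ A : E ≃L[ℂ] E, HasStrictFDerivAt (fun z => chartAt E (f x) (f ((chartAt E x).symm z)))
      (A : E →L[ℂ] E) (chartAt E x x) := by
  set e := chartAt E x
  set e' := chartAt E (f x)
  have he : e ∈ IsManifold.maximalAtlas 𝓘(ℂ, E) ω X := IsManifold.chart_mem_maximalAtlas x
  have he' : e' ∈ IsManifold.maximalAtlas 𝓘(ℂ, E) ω X := IsManifold.chart_mem_maximalAtlas (f x)
  have hxe : x ∈ e.source := mem_chart_source E x
  have hpt : e x ∈ e.target := e.map_source hxe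
  have hpx : e.symm (e x) = x := e.left_inv hxe
  have hed := mdifferentiable_of_mem_maximalAtlas he
  have hed' := mdifferentiable_of_mem_maximalAtlas he'
  have hfx : MDifferentiableAt 𝓘(ℂ, E) 𝓘(ℂ, E) f x := hf.mdifferentiableAt (hW.mem_nhds hx)
  have hev : ∀ᶠ z in 𝓝 (e x), DifferentiableAt ℂ (fun z => e' (f (e.symm z))) z := by
    have h1 : ∀ᶠ y in 𝓝 x, y ∈ W ∧ f y ∈ e'.source :=
      (hW.eventually_mem hx).and (hfx.continuousAt.eventually
        (e'.open_source.mem_nhds (mem_chart_source E (f x))))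
    have h2 : ∀ᶠ z in 𝓝 (e x), e.symm z ∈ W ∧ f (e.symm z) ∈ e'.source := by
      have := e.continuousAt_symm hpt
      rw [ContinuousAt, hpx] at this
      exact this.eventually h1
    filter_upwards [h2, e.open_target.mem_nhds hpt] with z hz hzt
    have h3 : MDifferentiableAt 𝓘(ℂ, E) 𝓘(ℂ, E) e.symm z :=
      hed.2.mdifferentiableAt (e.open_target.mem_nhds hzt)
    have h4 : MDifferentiableAt 𝓘(ℂ, E) 𝓘(ℂ, E) f (e.symm z) :=
      hf.mdifferentiableAt (hW.mem_nhds hz.1)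
    have h5 : MDifferentiableAt 𝓘(ℂ, E) 𝓘(ℂ, E) e' (f (e.symm z)) :=
      hed'.1.mdifferentiableAt (e'.open_source.mem_nhds hz.2)
    exact (h5.comp z (h4.comp z h3)).differentiableAt
  obtain ⟨V, hVsub, hV, hpV⟩ := _root_.mem_nhds_iff.1 hev
  have hc : ContDiffAt ℂ 1 (fun z => e' (f (e.symm z))) (e x) :=
    (contDiffOn_of_differentiableOn hV 1
      fun z hz => (hVsub hz : DifferentiableAt ℂ _ z).differentiableWithinAt).contDiffAt
        (hV.mem_nhds hpV)
  have hs := hc.hasStrictFDerivAt one_ne_zero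
  have h3 : MDifferentiableAt 𝓘(ℂ, E) 𝓘(ℂ, E) e.symm (e x) :=
    hed.2.mdifferentiableAt (e.open_target.mem_nhds hpt)
  have h5 : MDifferentiableAt 𝓘(ℂ, E) 𝓘(ℂ, E) e' (f x) :=
    hed'.1.mdifferentiableAt (e'.open_source.mem_nhds (mem_chart_source E (f x)))
  have hder : fderiv ℂ (fun z => e' (f (e.symm z))) (e x)
      = (tder E e' (f x)).comp ((tder E f x).comp (tder E e.symm (e x))) := by
    have h4 : MDifferentiableAt 𝓘(ℂ, E) 𝓘(ℂ, E) f (e.symm (e x)) := by rwa [hpx]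
    have h6 : MDifferentiableAt 𝓘(ℂ, E) 𝓘(ℂ, E) e' ((f ∘ e.symm) (e x)) := by
      rwa [Function.comp_apply, hpx]
    rw [← tder_eq_fderiv]
    have h7 := tder_comp h6 (h4.comp (e x) h3)
    rw [tder_comp h4 h3, Function.comp_apply, hpx] at h7
    exact h7
  have hinj : Function.Injective (fderiv ℂ (fun z => e' (f (e.symm z))) (e x)) := by
    rw [hder]
    have i1 : Function.Injective (tder E e' (f x)) :=
      (Function.LeftInverse.injective (g := tder E e'.symm (e' (f x)))
        fun v => tder_symm_tder he' (mem_chart_source E (f x)) v)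
    have i2 : Function.Injective (tder E e.symm (e x)) :=
      (Function.LeftInverse.injective (g := tder E e (e.symm (e x)))
        fun v => tder_tder_symm he hpt v)
    exact i1.comp (hd.comp i2)
  refine ⟨(LinearEquiv.ofInjectiveEndo _ hinj).toContinuousLinearEquiv, ?_⟩
  convert hs using 1
  ext v
  rfl

/-- An injective holomorphic map with injective derivatives is biholomorphic onto an open set. -/
theorem exists_openPartialHomeomorph_of_injOn {f : X → X} {W : Set X} (hW : IsOpen W)
    (hf : MDifferentiableOn 𝓘(ℂ, E) 𝓘(ℂ, E) f W) (hinj : InjOn f W)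
    (hd : ∀ x ∈ W, Function.Injective (tder E f x)) :
    ∃ F : OpenPartialHomeomorph X X, (F : X → X) = f ∧ F.source = W ∧
      MDifferentiableOn 𝓘(ℂ, E) 𝓘(ℂ, E) F.symm F.target := by
  have hfc : ∀ x ∈ W, ContinuousAt f x := fun x hx =>
    (hf.mdifferentiableAt (hW.mem_nhds hx)).continuousAt
  -- Openness at `x`: the coordinate expression is open at the base point by its invertible strict
  -- derivative, and the charts are then cancelled on both sides.
  have hmap : ∀ x ∈ W, 𝓝 (f x) ≤ map f (𝓝 x) := by
    intro x hx
    obtain ⟨A, hA⟩ := exists_hasStrictFDerivAt_chart hW hf hx (hd x hx)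
    set e := chartAt E x
    set e' := chartAt E (f x)
    have hxe : x ∈ e.source := mem_chart_source E x
    have hxe' : f x ∈ e'.source := mem_chart_source E (f x)
    have h1 := hA.map_nhds_eq_of_equiv
    rw [e.left_inv hxe, ← e.map_nhds_eq hxe, map_map, ← e'.map_nhds_eq hxe'] at h1
    have h2 : map (fun z => e' (f (e.symm z)) ) (map e (𝓝 x)) = map e' (map f (𝓝 x)) := by
      rw [map_map, map_map]
      refine map_congr ?_
      filter_upwards [e.open_source.mem_nhds hxe] with y hy
      simp [e.left_inv hy]
    rw [← map_map, h2] at h1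
    have h3 := congrArg (map e'.symm) h1
    have h4 : ∀ l : Filter X, e'.source ∈ l → map e'.symm (map e' l) = l := fun l hl => by
      rw [map_map]
      refine (map_congr ?_).trans map_id
      filter_upwards [hl] with y hy using e'.left_inv hy
    rw [h4 _ (hfc x hx (e'.open_source.mem_nhds hxe')), h4 _ (e'.open_source.mem_nhds hxe')] at h3
    exact h3.ge
  have hopen : IsOpenMap (W.domRestrict f) := by
    refine IsOpenMap.of_nhds_le fun x => ?_
    have h1 : map (W.domRestrict f) (𝓝 x) = map f (𝓝 (x : X)) := by
      rw [Set.domRestrict_eq, ← map_map, map_nhds_subtype_coe_eq_nhds x.2 (hW.mem_nhds x.2)]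
    rw [h1]
    exact hmap x x.2
  -- The inverse of a map injective on a set needs a default value off the image, hence the separate
  -- case of empty `X`.
  rcases isEmpty_or_nonempty X with hX | hX
  · refine ⟨OpenPartialHomeomorph.refl X, funext fun x => hX.elim x, ?_, fun x => hX.elim x⟩
    exact Subsingleton.elim _ _
  let F := OpenPartialHomeomorph.ofContinuousOpenRestrict (hinj.toPartialEquiv f W)
    (fun x hx => (hfc x hx).continuousWithinAt) hopen hW
  refine ⟨F, rfl, rfl, ?_⟩
  rintro y hy
  obtain ⟨x, hx, rfl⟩ : ∃ x ∈ W, f x = y := hy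
  have hy : f x ∈ F.target := F.map_source hx
  have hFx : F.symm (f x) = x := F.left_inv hx
  refine MDifferentiableAt.mdifferentiableWithinAt ?_
  obtain ⟨A, hA⟩ := exists_hasStrictFDerivAt_chart hW hf hx (hd x hx)
  set e := chartAt E x with hedef
  set e' := chartAt E (f x) with hedef'
  have hxe : x ∈ e.source := mem_chart_source E x
  have hxe' : f x ∈ e'.source := mem_chart_source E (f x)
  have hFc : ContinuousAt F.symm (f x) := F.continuousAt_symm hy
  have he'c : ContinuousAt e'.symm (e' (f x)) := e'.continuousAt_symm (e'.map_source hxe')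
  rw [mdifferentiableAt_iff]
  refine ⟨hFc, ?_⟩
  have hcomp : Tendsto (fun z => F.symm (e'.symm z)) (𝓝 (e' (f x))) (𝓝 x) := by
    rw [ContinuousAt, e'.left_inv hxe'] at he'c
    rw [ContinuousAt, hFx] at hFc
    exact hFc.comp he'c
  have hg : HasFDerivAt (fun z => e (F.symm (e'.symm z))) (A.symm : E →L[ℂ] E) (e' (f x)) := by
    refine HasFDerivAt.of_local_left_inverse (f := fun z => e' (f (e.symm z))) ?_ ?_ ?_
    · have h1 : Tendsto (fun z => e (F.symm (e'.symm z))) (𝓝 (e' (f x))) (𝓝 (e x)) :=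
        (e.continuousAt hxe).tendsto.comp hcomp
      simpa only [ContinuousAt, e'.left_inv hxe', hFx] using h1
    · simpa only [e'.left_inv hxe', hFx] using hA.hasFDerivAt
    · rw [ContinuousAt, e'.left_inv hxe'] at he'c
      filter_upwards [hcomp.eventually (e.open_source.mem_nhds hxe),
        e'.open_target.mem_nhds (e'.map_source hxe'),
        he'c.eventually (F.open_target.mem_nhds hy)] with z h1 h2 h3
      rw [e.left_inv h1]
      exact (congrArg e' (F.right_inv h3)).trans (e'.right_inv h2)
  have h1 := hg.differentiableAt.differentiableWithinAt (s := range 𝓘(ℂ, E))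
  have h2 : chartAt E (F.symm (f x)) = e := by rw [hFx]
  simp only [writtenInExtChartAt, extChartAt, h2]
  exact h1

end InverseFunction

end HolSymp

namespace HolSymp

/-! ### The time-one map and the relative equivariant theorem -/

section MoserFlow

set_option maxSynthPendingDepth 3

open Metric Filter Topology

variable {E : Type*} [NormedAddCommGroup E] [NormedSpace ℂ E]
  {X : Type*} [TopologicalSpace X] [ChartedSpace E X]
  {K : Type*} [Group K] [MulAction K X]
  {η₀ η₁ : TwoForm E X} {φ : ℝ → X → X} {U Y : Set X}

variable (K) in
/-- An open set on which the flow of the Moser vector field exists up to time `1`, is holomorphic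
at time `1`, and pulls back `η₁` to `η₀`. -/
def IsMoserFlowDomain (η₀ η₁ : TwoForm E X) (φ : ℝ → X → X) (U O : Set X) : Prop :=
  IsOpen O ∧ ∃ Γ : ℝ → X → X, ∀ x ∈ O, Γ 0 x = x ∧ IsMoserCurve K η₀ η₁ φ U (fun t => Γ t x) ∧
    MDifferentiableAt 𝓘(ℂ, E) 𝓘(ℂ, E) (Γ 1) x ∧
    ∀ u w, bilin η₁ (Γ 1 x) (tder E (Γ 1) x u) (tder E (Γ 1) x w) = bilin η₀ x u w

theorem IsMoserChart.mem_moserRegion {e : OpenPartialHomeomorph X E} {V : Set E}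
    {s : E → E →L[ℂ] ℂ} (h : IsMoserChart η₀ η₁ φ U e V s) {z : E} (hz : z ∈ V) :
    e.symm z ∈ moserRegion K η₀ η₁ φ U := by
  refine ⟨1, e, V, s, h, ?_, ?_⟩
  · rw [one_smul]
    exact e.map_target (h.subset_target hz)
  · rwa [one_smul, e.right_inv (h.subset_target hz)]

/-- Where the primitive vanishes, zero velocity solves Moser's equation. This is why the time-one
map fixes `Y`. -/
theorem IsMoserChart.isMoserCurve_const {e : OpenPartialHomeomorph X E} {V : Set E}
    {s : E → E →L[ℂ] ℂ} (h : IsMoserChart η₀ η₁ φ U e V s) {y : X} (hy : y ∈ e.source)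
    (hyV : e y ∈ V) (hs : s (e y) = 0) : IsMoserCurve K η₀ η₁ φ U (fun _ => y) := by
  have hreg := h.mem_moserRegion (K := K) hyV
  rw [e.left_inv hy] at hreg
  refine fun t _ => ⟨hreg, 0, hasVelocityWithinAt_const y univ t, fun w => ?_⟩
  have h1 := h.primitive_eq _ hyV (tder E e y w)
  rw [hs, tder_symm_tder h.mem_maximalAtlas hy, e.left_inv hy, zero_apply] at h1
  rw [← h1]
  simp

/-- The local flow is transported from the chart; the derivatives of the chart and of its inverse
cancel in the pull-back identity. -/
theorem IsMoserChart.exists_isMoserFlowDomain [FiniteDimensional ℂ E]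
    {e : OpenPartialHomeomorph X E} {V : Set E}
    {s : E → E →L[ℂ] ℂ} (h : IsMoserChart η₀ η₁ φ U e V s) {y : X} (hy : y ∈ e.source)
    (hyV : e y ∈ V) (hs : s (e y) = 0) : ∃ O, y ∈ O ∧ IsMoserFlowDomain K η₀ η₁ φ U O := by
  obtain ⟨ψ, hψ⟩ := h.isMoserData.exists_flow hyV hs
  obtain ⟨O, hO, hOo, hpO⟩ := _root_.mem_nhds_iff.1 hψ
  have hed := mdifferentiable_of_mem_maximalAtlas h.mem_maximalAtlas
  refine ⟨e.source ∩ e ⁻¹' O, ⟨hy, hpO⟩, e.isOpen_inter_preimage hOo,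
    fun t x => e.symm (ψ t (e x)), ?_⟩
  rintro x ⟨hx, hxO⟩
  obtain ⟨h0, hcurve, hd, hpull⟩ := hO hxO
  have hsymm : ∀ t ∈ Ioo (-1 : ℝ) 2, MDifferentiableAt 𝓘(ℂ, E) 𝓘(ℂ, E) e.symm (ψ t (e x)) :=
    fun t ht => hed.2.mdifferentiableAt
      (e.open_target.mem_nhds (h.subset_target (hcurve t ht).1))
  have hm1 := hsymm 1 (by norm_num)
  have hm2 : MDifferentiableAt 𝓘(ℂ, E) 𝓘(ℂ, E) (ψ 1) (e x) := hd.mdifferentiableAt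
  have hm3 : MDifferentiableAt 𝓘(ℂ, E) 𝓘(ℂ, E) e x :=
    hed.1.mdifferentiableAt (e.open_source.mem_nhds hx)
  refine ⟨?_, fun t ht => ?_, hm1.comp x (hm2.comp x hm3), fun u w => ?_⟩
  · simp only [h0, e.left_inv hx]
  · obtain ⟨hV, u, hu, hm⟩ := hcurve t ht
    exact ⟨h.mem_moserRegion hV, _, HasVelocityWithinAt.comp (γ := fun t => ψ t (e x)) (hsymm t ht)
      (hasVelocityWithinAt_iff_hasDerivWithinAt.2 hu.hasDerivWithinAt), h.moserEquation_symm hV hm⟩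
  · have h1 : tder E (fun x => e.symm (ψ 1 (e x))) x
        = (tder E e.symm (ψ 1 (e x))).comp ((fderiv ℂ (ψ 1) (e x)).comp (tder E e x)) := by
      rw [← tder_eq_fderiv, ← tder_comp hm2 hm3]
      exact tder_comp (f := fun x => ψ 1 (e x)) hm1 (hm2.comp x hm3)
    rw [h1]
    simp only [ContinuousLinearMap.comp_apply]
    rw [← chartBilin_apply, hpull, chartBilin_apply, tder_symm_tder h.mem_maximalAtlas hx,
      tder_symm_tder h.mem_maximalAtlas hx, e.left_inv hx]

variable (K) in
/-- The union of all domains on which the flow of the Moser vector field exists. -/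
def moserDomain (η₀ η₁ : TwoForm E X) (φ : ℝ → X → X) (U : Set X) : Set X :=
  ⋃₀ {O | IsMoserFlowDomain K η₀ η₁ φ U O}

open Classical in
variable (K) in
/-- The time-one map of the flow of the Moser vector field. -/
noncomputable def moserMap (η₀ η₁ : TwoForm E X) (φ : ℝ → X → X) (U : Set X) (x : X) : X :=
  if h : ∃ γ, IsMoserCurve K η₀ η₁ φ U γ ∧ γ 0 = x then h.choose 1 else x

theorem isOpen_moserDomain : IsOpen (moserDomain K η₀ η₁ φ U) :=
  isOpen_sUnion fun _ hO => hO.1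

theorem exists_isMoserCurve_of_mem_moserDomain {x : X} (hx : x ∈ moserDomain K η₀ η₁ φ U) :
    ∃ γ, IsMoserCurve K η₀ η₁ φ U γ ∧ γ 0 = x := by
  obtain ⟨O, hO, hxO⟩ := hx
  obtain ⟨-, Γ, hΓ⟩ := hO
  exact ⟨_, (hΓ x hxO).2.1, (hΓ x hxO).1⟩

namespace IsMoserAction

theorem moserDomain_subset (hK : IsMoserAction K η₀ η₁ φ U) : moserDomain K η₀ η₁ φ U ⊆ U := by
  intro x hx
  obtain ⟨γ, hγ, rfl⟩ := exists_isMoserCurve_of_mem_moserDomain hx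
  exact hK.moserRegion_subset (hγ 0 (by norm_num)).1

/-- Conjugating a flow by `k` gives a flow on the translated open set, and the pull-back identity
survives because both forms are invariant. -/
theorem smul_mem_moserDomain (hK : IsMoserAction K η₀ η₁ φ U) (hU : IsOpen U)
    (hφ : IsHolomorphicRetractionFamily E U Y φ) (k : K) {x : X}
    (hx : x ∈ moserDomain K η₀ η₁ φ U) : k • x ∈ moserDomain K η₀ η₁ φ U := by
  obtain ⟨O, ⟨hO, Γ, hΓ⟩, hxO⟩ := hx
  refine ⟨(fun x => k⁻¹ • x) ⁻¹' O, ⟨hO.preimage (hK.holomorphic k⁻¹).continuous,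
    fun t x => k • Γ t (k⁻¹ • x), ?_⟩, by simpa using hxO⟩
  intro z hz
  obtain ⟨h0, hcurve, hd, hpull⟩ := hΓ _ hz
  have hm2 := hK.holomorphic k⁻¹ z
  have hm1 := hK.holomorphic k (Γ 1 (k⁻¹ • z))
  refine ⟨?_, hK.isMoserCurve_smul hU hφ k hcurve, hm1.comp z (hd.comp z hm2), fun u w => ?_⟩
  · simp only [h0, smul_inv_smul]
  · have h1 : tder E (fun x => k • Γ 1 (k⁻¹ • x)) z
        = (tder E (fun x : X => k • x) (Γ 1 (k⁻¹ • z))).comp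
          ((tder E (Γ 1) (k⁻¹ • z)).comp (tder E (fun x : X => k⁻¹ • x) z)) := by
      rw [← tder_comp hd hm2]
      exact tder_comp (f := fun x => Γ 1 (k⁻¹ • x)) hm1 (hd.comp z hm2)
    rw [h1]
    simp only [ContinuousLinearMap.comp_apply]
    rw [hK.bilin_smul_one, hpull, hK.bilin_smul_zero]

variable [FiniteDimensional ℂ E] [T2Space X]

/-- By uniqueness the chosen curve is immaterial, so any integral curve through a point computes the
time-one map there. -/
theorem moserMap_eq (hK : IsMoserAction K η₀ η₁ φ U) (hU : IsOpen U)
    (hφ : IsHolomorphicRetractionFamily E U Y φ) {γ : ℝ → X} (hγ : IsMoserCurve K η₀ η₁ φ U γ) :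
    moserMap K η₀ η₁ φ U (γ 0) = γ 1 := by
  have h : ∃ δ, IsMoserCurve K η₀ η₁ φ U δ ∧ δ 0 = γ 0 := ⟨γ, hγ, rfl⟩
  rw [moserMap, dif_pos h]
  exact hK.eqOn_of_isMoserCurve hU hφ h.choose_spec.1 hγ (t₀ := 0) (by norm_num) h.choose_spec.2
    (show (1 : ℝ) ∈ Ioo (-1 : ℝ) 2 by norm_num)

/-- Uniqueness applied at time `1`: integral curves that meet there coincide, hence have the same
starting point. -/
theorem injOn_moserMap (hK : IsMoserAction K η₀ η₁ φ U) (hU : IsOpen U)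
    (hφ : IsHolomorphicRetractionFamily E U Y φ) :
    InjOn (moserMap K η₀ η₁ φ U) (moserDomain K η₀ η₁ φ U) := by
  intro x hx y hy hxy
  obtain ⟨γ, hγ, rfl⟩ := exists_isMoserCurve_of_mem_moserDomain hx
  obtain ⟨δ, hδ, rfl⟩ := exists_isMoserCurve_of_mem_moserDomain hy
  rw [hK.moserMap_eq hU hφ hγ, hK.moserMap_eq hU hφ hδ] at hxy
  exact hK.eqOn_of_isMoserCurve hU hφ hγ hδ (t₀ := 1) (by norm_num) hxy
    (show (0 : ℝ) ∈ Ioo (-1 : ℝ) 2 by norm_num)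

theorem moserMap_smul (hK : IsMoserAction K η₀ η₁ φ U) (hU : IsOpen U)
    (hφ : IsHolomorphicRetractionFamily E U Y φ) (k : K) {x : X}
    (hx : x ∈ moserDomain K η₀ η₁ φ U) :
    moserMap K η₀ η₁ φ U (k • x) = k • moserMap K η₀ η₁ φ U x := by
  obtain ⟨γ, hγ, rfl⟩ := exists_isMoserCurve_of_mem_moserDomain hx
  rw [hK.moserMap_eq hU hφ hγ]
  exact hK.moserMap_eq hU hφ (hK.isMoserCurve_smul hU hφ k hγ)

/-- On each flow domain the time-one map coincides with the holomorphic map `Γ 1`, from which both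
properties are inherited. -/
theorem mdifferentiableAt_moserMap (hK : IsMoserAction K η₀ η₁ φ U) (hU : IsOpen U)
    (hφ : IsHolomorphicRetractionFamily E U Y φ) {x : X}
    (hx : x ∈ moserDomain K η₀ η₁ φ U) :
    MDifferentiableAt 𝓘(ℂ, E) 𝓘(ℂ, E) (moserMap K η₀ η₁ φ U) x ∧
      ∀ u w, bilin η₁ (moserMap K η₀ η₁ φ U x) (tder E (moserMap K η₀ η₁ φ U) x u)
        (tder E (moserMap K η₀ η₁ φ U) x w) = bilin η₀ x u w := by
  obtain ⟨O, ⟨hO, Γ, hΓ⟩, hxO⟩ := hx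
  have heq : ∀ z ∈ O, moserMap K η₀ η₁ φ U z = Γ 1 z := fun z hz => by
    have := hK.moserMap_eq hU hφ (hΓ z hz).2.1
    rwa [(hΓ z hz).1] at this
  have hev : moserMap K η₀ η₁ φ U =ᶠ[𝓝 x] Γ 1 := by
    filter_upwards [hO.mem_nhds hxO] with z hz using heq z hz
  obtain ⟨-, -, hd, hpull⟩ := hΓ x hxO
  refine ⟨hd.congr_of_eventuallyEq hev, ?_⟩
  rw [tder_congr hev, heq x hxO]
  exact hpull

/-- The relative equivariant Moser theorem. -/
theorem exists_isRelativeSymplectomorphism [IsManifold 𝓘(ℂ, E) ω X]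
    (hK : IsMoserAction K η₀ η₁ φ U) (hU : IsOpen U) (hYU : Y ⊆ U)
    (hφ : IsHolomorphicRetractionFamily E U Y φ)
    (h₀ : IsHolomorphicSymplectic η₀) (h₁ : IsHolomorphicSymplectic η₁)
    (hY : ∀ y ∈ Y, η₀ y = η₁ y) :
    ∃ f : OpenPartialHomeomorph X X, IsRelativeSymplectomorphism η₀ η₁ Y U f ∧
      ∀ k : K, ∀ x ∈ f.source, k • x ∈ f.source ∧ f (k • x) = k • f x := by
  have hd : ∀ x ∈ moserDomain K η₀ η₁ φ U, _ := fun x hx =>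
    hK.mdifferentiableAt_moserMap hU hφ hx
  have hdiff : MDifferentiableOn 𝓘(ℂ, E) 𝓘(ℂ, E) (moserMap K η₀ η₁ φ U)
      (moserDomain K η₀ η₁ φ U) := fun x hx => (hd x hx).1.mdifferentiableWithinAt
  obtain ⟨F, hFf, hFs, hFi⟩ := exists_openPartialHomeomorph_of_injOn isOpen_moserDomain hdiff
    (hK.injOn_moserMap hU hφ) fun x hx => by
      -- The pull-back of the second form is the first one, which is nondegenerate; hence the
      -- derivative has no kernel.
      refine (injective_iff_map_eq_zero _).2 fun u hu => h₀.bilin_nondegenerate x u fun w => ?_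
      rw [← (hd x hx).2 u w, hu, map_zero, zero_apply]
  refine ⟨F, ⟨?_, ?_, ?_, hFi, ?_, ?_⟩, ?_⟩
  · intro y hy
    obtain ⟨V, s, h, hV, hs⟩ := exists_isMoserChart hU hYU hφ h₀ h₁ hY hy
    obtain ⟨O, hyO, hO⟩ := h.exists_isMoserFlowDomain (K := K) (mem_chart_source E y) hV hs
    rw [hFs]
    exact ⟨O, hO, hyO⟩
  · rw [hFs]
    exact hK.moserDomain_subset
  · rwa [hFs, hFf]
  · intro y hy
    obtain ⟨V, s, h, hV, hs⟩ := exists_isMoserChart hU hYU hφ h₀ h₁ hY hy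
    rw [hFf]
    exact hK.moserMap_eq hU hφ (h.isMoserCurve_const (K := K) (mem_chart_source E y) hV hs)
  · intro x hx
    rw [hFs] at hx
    rw [hFf]
    ext m
    have h1 : m = ![m 0, m 1] := by
      ext i
      fin_cases i <;> rfl
    have h2 := (bilin_pullback (moserMap K η₀ η₁ φ U) η₁ x (m 0) (m 1)).trans
      ((hd x hx).2 (m 0) (m 1))
    rw [h1]
    exact ((toBilin_apply (E := E) _ _ _).symm.trans h2).trans (toBilin_apply (E := E) _ _ _)
  · intro k x hx
    rw [hFs] at hx ⊢
    rw [hFf]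
    exact ⟨hK.smul_mem_moserDomain hU hφ k hx, hK.moserMap_smul hU hφ k hx⟩

end IsMoserAction

/-- The statement without a group is the equivariant one for a trivial group; the trivial subgroup
of the permutations of `X` comes with an action on `X`. -/
theorem isMoserAction_bot :
    IsMoserAction (⊥ : Subgroup (Equiv.Perm X)) η₀ η₁ φ U := by
  have h : ∀ k : (⊥ : Subgroup (Equiv.Perm X)), (fun x : X => k • x) = id := fun k => by
    rw [Subsingleton.elim k 1]
    exact funext fun x => one_smul _ x
  have h' : ∀ (k : (⊥ : Subgroup (Equiv.Perm X))) (x : X), k • x = x := fun k =>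
    congrFun (h k)
  have hp : ∀ (k : (⊥ : Subgroup (Equiv.Perm X))) (η : TwoForm E X),
      pullback (fun x : X => k • x) η = η := fun k η => by
    rw [h]
    funext x
    rw [pullback, mfderiv_id]
    rfl
  refine ⟨fun k => ?_, fun k => hp k _, fun k => hp k _, fun k x hx => ?_,
    fun k t _ x _ => ?_⟩
  · rw [h]
    exact mdifferentiable_id
  · rwa [h']
  · rw [h', h']

end MoserFlow

end HolSymp

theorem mainTheorem8 {E : Type*} [NormedAddCommGroup E] [NormedSpace ℂ E] [FiniteDimensional ℂ E]
    {X : Type*} [TopologicalSpace X] [T2Space X] [ChartedSpace E X] [IsManifold 𝓘(ℂ, E) ω X]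
    (η₀ η₁ : HolSymp.TwoForm E X)
    (h₀ : HolSymp.IsHolomorphicSymplectic η₀) (h₁ : HolSymp.IsHolomorphicSymplectic η₁)
    (Y : Set X) (hY : HolSymp.IsComplexSubmanifold E Y)
    (hcoincide : ∀ y ∈ Y, η₀ y = η₁ y)
    (U : Set X) (hU : IsOpen U) (hYU : Y ⊆ U)
    (φ : ℝ → X → X) (hφ : HolSymp.IsHolomorphicRetractionFamily E U Y φ) :
    (∃ f : OpenPartialHomeomorph X X, HolSymp.IsRelativeSymplectomorphism η₀ η₁ Y U f) ∧
    ∀ {EK : Type*} [NormedAddCommGroup EK] [NormedSpace ℝ EK] [FiniteDimensional ℝ EK]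
      {K : Type*} [TopologicalSpace K] [T2Space K] [CompactSpace K] [ChartedSpace EK K]
      [Group K] [LieGroup 𝓘(ℝ, EK) ∞ K]
      [MulAction K X] [ContMDiffSMul 𝓘(ℝ, EK) 𝓘(ℝ, E) ∞ K X],
      (∀ k : K, MDifferentiable 𝓘(ℂ, E) 𝓘(ℂ, E) (fun x : X => k • x)) →
      (∀ k : K, HolSymp.pullback (fun x : X => k • x) η₀ = η₀) →
      (∀ k : K, HolSymp.pullback (fun x : X => k • x) η₁ = η₁) →
      (∀ k : K, ∀ y ∈ Y, k • y ∈ Y) →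
      (∀ k : K, ∀ x ∈ U, k • x ∈ U) →
      (∀ k : K, ∀ t ∈ Icc (0 : ℝ) 1, ∀ x ∈ U, φ t (k • x) = k • φ t x) →
      ∃ f : OpenPartialHomeomorph X X, HolSymp.IsRelativeSymplectomorphism η₀ η₁ Y U f ∧
        ∀ k : K, ∀ x ∈ f.source, k • x ∈ f.source ∧ f (k • x) = k • f x := by
  refine ⟨?_, fun {_} _ _ _ {K} _ _ _ _ _ _ _ _ hhol hpull₀ hpull₁ _ hUK heq => ?_⟩
  · obtain ⟨f, hf, -⟩ := (HolSymp.isMoserAction_bot (η₀ := η₀) (η₁ := η₁) (φ := φ)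
      (U := U)).exists_isRelativeSymplectomorphism hU hYU hφ h₀ h₁ hcoincide
    exact ⟨f, hf⟩
  · have hK : HolSymp.IsMoserAction K η₀ η₁ φ U := ⟨hhol, hpull₀, hpull₁, hUK, heq⟩
    exact hK.exists_isRelativeSymplectomorphism hU hYU hφ h₀ h₁ hcoincide
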